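/- **Conventions.** A *lattice simplex* of dimension $d$ in $\mathbb{R}^d$ is the convex hull of $d+1$ affinely independent points of $\mathbb{Z}^d$. The *$\delta$-polynomial* of a lattice polytope $\mathcal P\subset\mathbb{R}^d$ of dimension $d$ is the polynomial $$\delta(\mathcal P,t)=(1-t)^{d+1}\Bigl(1+\sum_{n\ge 1}|n\mathcal P\cap\mathbb{Z}^d|\,t^n\Bigr).$$ Two lattice polytopes $\mathcal P,\mathcal Q\subset\mathbb{R}^d$ are *unimodularly equivalent* if $\mathcal Q=\{xU+w : x\in\mathcal P\}$ for some $U\in\mathbb{Z}^{d\times d}$ with $\det U=\pm1$ and some $w\in\mathbb{Z}^d$ (polytopes in spaces of different dimensions are not equivalent). A lattice simplex of dimension $d$ in $\mathbb{R}^d$ is a *lattice pyramid* over a lower-dimensional lattice simplex if it is unimodularly equivalent to $\operatorname{conv}\bigl(\mathcal Q\times\{0\}\cup\{(0,\dots,0,1)\}\bigr)$ for some lattice simplex $\mathcal Q\subset\mathbb{R}^{d-1}$ of dimension $d-1$. For integers $a_1,\dots,a_d$ and $A=(a_1,\dots,a_d)$, let $\Delta(A)\subset\mathbb{R}^d$ be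 the convex hull of the origin, the unit vectors $e_1,\dots,e_{d-1}$ and $(a_d-a_1,\dots,a_d-a_{d-1},a_d)$. For sequences of integers $B=(b_1,\dots,b_s)$ and $C=(c_1,\dots,c_d)$ with $1\le s<d$, let $\Delta(B,C)\subset\mathbb{R}^d$ be the convex hull of the origin, the unit vectors $e_i$ with $1\le i\le d$ and $i\ne s,d$, and the two points $(b_s-b_1,\dots,b_s-b_{s-1},b_s,0,\dots,0)$ and $(c_d-c_1,\dots,c_d-c_{d-1},c_d)$. **Corollary.** Let $p\neq q$ be prime numbers, let $k\ge 0$ be an integer, and let $\Delta\subset\mathbb{R}^d$ be a lattice simplex of dimension $d$ whose $\delta$-polynomial is $$1+t^{k+1}+t^{2(k+1)}+\cdots+t^{(pq-1)(k+1)}.$$ Suppose that $\Delta$ is not a lattice pyramid over any lower-dimensional lattice simplex. Then $\Delta$ is unimodularly equivalent to one of $\Delta(A_1)$, $\Delta(A_2)$, $\Delta(A_3)$, $\Delta(B_1,C_1)$ and $\Delta(B_2,C_2)$, where 1. $A_1=(\underbrace{1,\ldots,1}_{pq(k+1)-2},\,pq)$; 2. $B_1=(\underbrace{1,\ldots,1}_{p(k+1)-1},\,p)$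 and $C_1=(\underbrace{q,\ldots,q}_{p(k+1)},\,\underbrace{1,\ldots,1}_{pq(k+1)-2},\,q)$; 3. $B_2=(\underbrace{1,\ldots,1}_{q(k+1)-1},\,q)$ and $C_2=(\underbrace{p,\ldots,p}_{q(k+1)},\,\underbrace{1,\ldots,1}_{pq(k+1)-2},\,p)$; 4. $A_2=(\underbrace{1,\ldots,1}_{p(k+1)-1},\,\underbrace{p,\ldots,p}_{(pq-1)(k+1)-1},\,pq)$; 5. $A_3=(\underbrace{1,\ldots,1}_{q(k+1)-1},\,\underbrace{q,\ldots,q}_{(pq-1)(k+1)-1},\,pq)$. -/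

import Mathlib

open scoped Pointwise Matrix Polynomial

noncomputable section

/-- The real vector with the given integer coordinates. -/
def intVec {d : ℕ} (x : Fin d → ℤ) : Fin d → ℝ := fun i => (x i : ℝ)

/-- `P ⊂ ℝ^d` is a lattice simplex of dimension `d`: the convex hull of `d + 1` affinely
independent points of `ℤ^d`. -/
def IsLatticeSimplex {d : ℕ} (P : Set (Fin d → ℝ)) : Prop :=
  ∃ v : Fin (d + 1) → Fin d → ℤ,
    AffineIndependent ℝ (fun i => intVec (v i)) ∧
      P = convexHull ℝ (Set.range fun i => intVec (v i))

/-- The number `|nP ∩ ℤ^d|` of lattice points in the `n`-th dilate of `P`. -/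
def latticePointCount {d : ℕ} (P : Set (Fin d → ℝ)) (n : ℕ) : ℕ :=
  Set.ncard {x : Fin d → ℤ | intVec x ∈ (n : ℝ) • P}

/-- The series `1 + ∑_{n ≥ 1} |nP ∩ ℤ^d| t^n`. -/
def ehrhartSeries {d : ℕ} (P : Set (Fin d → ℝ)) : PowerSeries ℤ :=
  PowerSeries.mk fun n => if n = 0 then 1 else (latticePointCount P n : ℤ)

/-- `f` is the `δ`-polynomial of the `d`-dimensional lattice polytope `P ⊂ ℝ^d`:
`f(t) = (1 - t)^(d+1) * (1 + ∑_{n ≥ 1} |nP ∩ ℤ^d| t^n)` as formal power series. -/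
def IsDeltaPolynomial {d : ℕ} (P : Set (Fin d → ℝ)) (f : ℤ[X]) : Prop :=
  (f : PowerSeries ℤ) = (1 - PowerSeries.X) ^ (d + 1) * ehrhartSeries P

/-- `P ⊂ ℝ^d` and `Q ⊂ ℝ^e` are unimodularly equivalent: `d = e`, and `Q` is the image of `P`
under `x ↦ x U + w` for an integer matrix `U` of determinant `±1` and an integer vector `w`. -/
def UnimodularlyEquivalent {d e : ℕ} (P : Set (Fin d → ℝ)) (Q : Set (Fin e → ℝ)) : Prop :=
  ∃ (h : e = d) (U : Matrix (Fin d) (Fin d) ℤ) (w : Fin d → ℤ),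
    (U.det = 1 ∨ U.det = -1) ∧
      Q = (fun (x : Fin d → ℝ) (i : Fin e) =>
        (x ᵥ* U.map (Int.cast : ℤ → ℝ) + intVec w) (Fin.cast h i)) '' P

/-- The lattice pyramid `conv (P × {0} ∪ {(0, …, 0, 1)}) ⊂ ℝ^(d+1)` over `P ⊂ ℝ^d`. -/
def latticePyramid {d : ℕ} (P : Set (Fin d → ℝ)) : Set (Fin (d + 1) → ℝ) :=
  convexHull ℝ
    ((fun x : Fin d → ℝ => (Fin.snoc x 0 : Fin (d + 1) → ℝ)) '' P ∪ {Pi.single (Fin.last d) 1})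

/-- `P ⊂ ℝ^d` is, up to unimodular equivalence, the lattice pyramid over some lattice simplex
`Q ⊂ ℝ^(d-1)` of dimension `d - 1`. -/
def IsLatticePyramid {d : ℕ} (P : Set (Fin d → ℝ)) : Prop :=
  ∃ (e : ℕ) (Q : Set (Fin e → ℝ)),
    IsLatticeSimplex Q ∧ UnimodularlyEquivalent P (latticePyramid Q)

end

/-- For `A = (a_1, …, a_d)`, the `d × d` matrix whose first `d - 1` rows are those of the
identity matrix and whose last row is `(a_d - a_1, …, a_d - a_{d-1}, a_d)`. -/
def vertexMatrixA (A : List ℤ) : Matrix (Fin A.length) (Fin A.length) ℤ :=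
  Matrix.of fun i j =>
    if i.val + 1 = A.length then
      if j = i then A[i] else A[i] - A[j]
    else if i = j then 1 else 0

/-- For `B = (b_1, …, b_s)` and `C = (c_1, …, c_d)` with `1 ≤ s < d`, the `d × d` matrix whose
`s`-th row is `(b_s - b_1, …, b_s - b_{s-1}, b_s, 0, …, 0)`, whose last row is
`(c_d - c_1, …, c_d - c_{d-1}, c_d)`, and whose other rows are those of the identity matrix. -/
def vertexMatrixBC (B C : List ℤ) : Matrix (Fin C.length) (Fin C.length) ℤ :=
  Matrix.of fun i j =>
    if i.val + 1 = C.length then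
      if j = i then C[i] else C[i] - C[j]
    else if i.val + 1 = B.length then
      if j = i then B.getD i 0
      else if j < i then B.getD i 0 - B.getD j 0
      else 0
    else if i = j then 1 else 0

/-- The convex hull of the origin and the rows of an integer matrix. -/
def hullOriginRows {d : ℕ} (M : Matrix (Fin d) (Fin d) ℤ) : Set (Fin d → ℝ) :=
  convexHull ℝ (insert 0 (Set.range fun i => intVec (M i)))

/-- The polytope `Δ(A) ⊂ ℝ^d`, where `d` is the length of `A`. -/
def simplexA (A : List ℤ) : Set (Fin A.length → ℝ) :=
  hullOriginRows (vertexMatrixA A)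

/-- The polytope `Δ(B, C) ⊂ ℝ^d`, where `d` is the length of `C`. -/
def simplexBC (B C : List ℤ) : Set (Fin C.length → ℝ) :=
  hullOriginRows (vertexMatrixBC B C)

/-! Attach to vertices `v` the group Λ = `coordLattice v` of real coefficient vectors whose
combinations of the vectors (v_i, 1) are integral. It contains ℤ^(d+1), and each class of Λ/ℤ^(d+1)
has one representative in [0,1)^(d+1), its box point. Splitting coefficients into integer and
fractional parts shows that the δ-polynomial counts box points by coordinate sum
(`card_boxPoints_height`). With K = k + 1, the hypothesis says that height divided by K is a
bijection from G = Λ/ℤ^(d+1) onto {0, …, pq − 1}. This function is subadditive because fractional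
parts are.

Let α have height 1. Its order is pq, q or p. An injective function bounded by the identity on an
initial segment is the identity, so heights are additive on the multiples of α. If α has order q, an
element β of height q supplies the missing index p, with heights mq + l for mβ + lα; order p is
symmetric (`exists_generators`).

Additivity of heights up to the largest multiples leaves no room for carries in any coordinate
(`lt_one_of_sum_fract_eq`). Together with the torsion relations and the absence of pyramid vertices,
this fixes the coordinates: all 1/(pq) in the cyclic case, and otherwise one of two patterns on a
set T and its complement (`coordLattice_cyclic`, `coordLattice_two_types`). The coordinate sums give
the sizes of these sets.

Finally, Λ determines the simplex up to unimodular equivalence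
(`unimodularlyEquivalent_of_coordLattice_eq`), and a coordinate that is integral on all of Λ makes
the simplex a pyramid (`isLatticePyramid_of_coord_integral`). It remains to compute Λ for the listed
simplices and match coordinates by a permutation of vertices. -/

/-- The integers, as a subring of the real numbers. -/
def intReals : Subring ℝ := (Int.castRingHom ℝ).range

theorem mem_intReals {r : ℝ} : r ∈ intReals ↔ ∃ n : ℤ, (n : ℝ) = r := by
  simp [intReals, RingHom.mem_range]

theorem fract_eq_zero_of_mem_intReals {r : ℝ} (h : r ∈ intReals) : Int.fract r = 0 := by
  obtain ⟨n, rfl⟩ := mem_intReals.1 h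
  exact Int.fract_intCast n

theorem fract_eq_fract_iff_sub_mem {r s : ℝ} : Int.fract r = Int.fract s ↔ r - s ∈ intReals := by
  rw [Int.fract_eq_fract, mem_intReals]
  exact ⟨fun ⟨z, hz⟩ => ⟨z, hz.symm⟩, fun ⟨z, hz⟩ => ⟨z, hz.symm⟩⟩

theorem sub_fract_mem_intReals (r : ℝ) : r - Int.fract r ∈ intReals :=
  mem_intReals.2 ⟨⌊r⌋, by simp⟩

/-- The vectors with integer entries. -/
def intVectors (ι : Type*) : AddSubgroup (ι → ℝ) where
  carrier := {x | ∀ i, x i ∈ intReals}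
  add_mem' {_ _} hx hy i := add_mem (hx i) (hy i)
  zero_mem' _ := zero_mem _
  neg_mem' hx i := neg_mem (hx i)

theorem exists_intVec_eq {d : ℕ} {x : Fin d → ℝ} (hx : ∀ i, x i ∈ intReals) :
    ∃ z : Fin d → ℤ, intVec z = x := by
  choose z hz using fun i => mem_intReals.1 (hx i)
  exact ⟨z, funext hz⟩

theorem intVec_apply_mem {d : ℕ} (z : Fin d → ℤ) (i : Fin d) : intVec z i ∈ intReals :=
  mem_intReals.2 ⟨z i, rfl⟩

theorem intVec_injective {d : ℕ} : Function.Injective (intVec (d := d)) := fun _ _ h =>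
  funext fun i => Int.cast_injective (congrFun h i)

/-! ### Coefficient lattices, dilates and box points. -/

section Coordinates

variable {ι : Type*} [Fintype ι] {d : ℕ}

/-- The coefficient vectors `x` such that `∑ xᵢ (vᵢ, 1)` is an integer vector. -/
def coordLattice (v : ι → Fin d → ℤ) : AddSubgroup (ι → ℝ) where
  carrier := {x | ∑ i, x i ∈ intReals ∧ ∀ j, ∑ i, x i * v i j ∈ intReals}
  add_mem' := by
    rintro x y ⟨hx, hx'⟩ ⟨hy, hy'⟩
    refine ⟨?_, fun j => ?_⟩
    · simpa [Finset.sum_add_distrib] using add_mem hx hy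
    · simpa [add_mul, Finset.sum_add_distrib] using add_mem (hx' j) (hy' j)
  zero_mem' := by simp [zero_mem]
  neg_mem' := by
    rintro x ⟨hx, hx'⟩
    refine ⟨?_, fun j => ?_⟩
    · simpa using neg_mem hx
    · simpa using neg_mem (hx' j)

theorem mem_coordLattice {v : ι → Fin d → ℤ} {x : ι → ℝ} :
    x ∈ coordLattice v ↔ ∑ i, x i ∈ intReals ∧ ∀ j, ∑ i, x i * v i j ∈ intReals := Iff.rfl

theorem intVectors_le_coordLattice (v : ι → Fin d → ℤ) : intVectors ι ≤ coordLattice v := by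
  intro x hx
  exact ⟨sum_mem fun i _ => hx i, fun j => sum_mem fun i _ => mul_mem (hx i) (intCast_mem _ _)⟩

theorem fract_mem_coordLattice {v : ι → Fin d → ℤ} {x : ι → ℝ} (hx : x ∈ coordLattice v) :
    (fun i => Int.fract (x i)) ∈ coordLattice v := by
  have h : (x - fun i => Int.fract (x i)) ∈ coordLattice v :=
    intVectors_le_coordLattice v fun i => sub_fract_mem_intReals (x i)
  simpa using sub_mem hx h

/-- Scaling convex weights by n gives this for n > 0. For n = 0 both sides mean z = 0, which needs
the hull to be nonempty. -/
theorem mem_natCast_smul_convexHull_range {E : Type*} [AddCommGroup E] [Module ℝ E] [Nonempty ι]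
    (u : ι → E) (n : ℕ) (z : E) :
    z ∈ (n : ℝ) • convexHull ℝ (Set.range u) ↔
      ∃ x : ι → ℝ, (∀ i, 0 ≤ x i) ∧ ∑ i, x i = n ∧ ∑ i, x i • u i = z := by
  constructor
  · rintro ⟨y, hy, rfl⟩
    rw [convexHull_range_eq_exists_affineCombination] at hy
    obtain ⟨s, w, hw, hw1, rfl⟩ := hy
    classical
    refine ⟨fun i => n * (if i ∈ s then w i else 0), fun i => ?_, ?_, ?_⟩
    · by_cases hi : i ∈ s
      · simpa [hi] using mul_nonneg (Nat.cast_nonneg n) (hw i hi)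
      · simp [hi]
    · rw [← Finset.mul_sum]
      simp [hw1]
    · rw [Finset.affineCombination_eq_linear_combination _ _ _ hw1]
      simp [mul_smul, ← Finset.smul_sum, ite_smul]
  · rintro ⟨x, hx, hxn, rfl⟩
    rcases Nat.eq_zero_or_pos n with rfl | hn
    · have h0 : ∀ i, x i = 0 := by
        have := (Finset.sum_eq_zero_iff_of_nonneg (fun i _ => hx i)).1 (by simpa using hxn)
        exact fun i => this i (Finset.mem_univ i)
      refine ⟨u (Classical.arbitrary ι), subset_convexHull ℝ _ ⟨_, rfl⟩, ?_⟩
      simp [h0]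
    · have hn' : (n : ℝ) ≠ 0 := by positivity
      refine ⟨∑ i, (x i / n) • u i, ?_, ?_⟩
      · refine (convex_convexHull ℝ _).sum_mem (fun i _ => div_nonneg (hx i) (by positivity)) ?_
          fun i _ => subset_convexHull ℝ _ ⟨i, rfl⟩
        rw [← Finset.sum_div, hxn, div_self hn']
      · simp only [Finset.smul_sum, smul_smul]
        refine Finset.sum_congr rfl fun i _ => ?_
        rw [mul_div_cancel₀ _ hn']

theorem AffineIndependent.coeff_unique {E : Type*} [AddCommGroup E] [Module ℝ E] {u : ι → E}
    (hu : AffineIndependent ℝ u) {x y : ι → ℝ} (h : ∑ i, x i = ∑ i, y i)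
    (h' : ∑ i, x i • u i = ∑ i, y i • u i) : x = y := by
  funext i
  have := affineIndependent_iff.1 hu Finset.univ (fun i => x i - y i)
    (by simp [Finset.sum_sub_distrib, h]) (by simp [sub_smul, Finset.sum_sub_distrib, h'])
    i (Finset.mem_univ i)
  linarith

theorem sum_smul_intVec_apply (v : ι → Fin d → ℤ) (x : ι → ℝ) (j : Fin d) :
    (∑ i, x i • intVec (v i)) j = ∑ i, x i * v i j := by
  simp [intVec, Finset.sum_apply]

/-- The coefficient vectors of the lattice points of the `n`-th dilate. -/
def dilatePoints (v : ι → Fin d → ℤ) (n : ℕ) : Set (ι → ℝ) :=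
  {x | x ∈ coordLattice v ∧ (∀ i, 0 ≤ x i) ∧ ∑ i, x i = n}

/-- The coefficient vectors of the lattice points of the half-open fundamental parallelepiped. -/
def boxPoints (v : ι → Fin d → ℤ) : Set (ι → ℝ) :=
  {x | x ∈ coordLattice v ∧ ∀ i, 0 ≤ x i ∧ x i < 1}

theorem image_dilatePoints [Nonempty ι] (v : ι → Fin d → ℤ) (n : ℕ) :
    intVec '' {z : Fin d → ℤ | intVec z ∈ (n : ℝ) • convexHull ℝ (Set.range fun i => intVec (v i))} =
      (fun x : ι → ℝ => ∑ i, x i • intVec (v i)) '' dilatePoints v n := by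
  ext y
  constructor
  · rintro ⟨z, hz, rfl⟩
    obtain ⟨x, hx, hn, hxz⟩ := (mem_natCast_smul_convexHull_range _ n _).1 hz
    refine ⟨x, ⟨⟨hn ▸ natCast_mem _ _, fun j => ?_⟩, hx, hn⟩, hxz⟩
    rw [← sum_smul_intVec_apply, hxz]
    exact intVec_apply_mem z j
  · rintro ⟨x, ⟨⟨-, hx⟩, hx0, hn⟩, rfl⟩
    obtain ⟨z, hz⟩ := exists_intVec_eq (x := ∑ i, x i • intVec (v i)) fun j => by
      rw [sum_smul_intVec_apply]; exact hx j
    exact ⟨z, (mem_natCast_smul_convexHull_range _ n _).2 ⟨x, hx0, hn, hz.symm⟩, hz⟩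

theorem injOn_dilatePoints {v : ι → Fin d → ℤ} (hv : AffineIndependent ℝ fun i => intVec (v i))
    (n : ℕ) : Set.InjOn (fun x : ι → ℝ => ∑ i, x i • intVec (v i)) (dilatePoints v n) := by
  rintro x ⟨-, -, hx⟩ y ⟨-, -, hy⟩ h
  exact hv.coeff_unique (hx.trans hy.symm) h

theorem latticePointCount_eq_ncard [Nonempty ι] {v : ι → Fin d → ℤ}
    (hv : AffineIndependent ℝ fun i => intVec (v i)) (n : ℕ) :
    latticePointCount (convexHull ℝ (Set.range fun i => intVec (v i))) n =
      (dilatePoints v n).ncard := by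
  rw [latticePointCount, ← Set.ncard_image_of_injective _ intVec_injective, image_dilatePoints,
    (injOn_dilatePoints hv n).ncard_image]

theorem finite_dilatePoints [Nonempty ι] {v : ι → Fin d → ℤ}
    (hv : AffineIndependent ℝ fun i => intVec (v i)) (n : ℕ) : (dilatePoints v n).Finite := by
  refine Set.Finite.of_finite_image ?_ (injOn_dilatePoints hv n)
  rw [← image_dilatePoints]
  refine Set.Finite.image _ ?_
  -- Each coefficient lies in [0, n], which bounds every coordinate of the lattice point.
  let B : Fin d → ℤ := fun j => ∑ i, n * |v i j|
  refine (Set.finite_Icc (-B) B).subset fun z hz => ?_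
  obtain ⟨x, hx, hn, hxz⟩ := (mem_natCast_smul_convexHull_range _ n _).1 hz
  have key : ∀ j, |z j| ≤ B j := by
    intro j
    have h1 : (z j : ℝ) = ∑ i, x i * v i j := by rw [← sum_smul_intVec_apply, hxz]; rfl
    have h2 : |(z j : ℝ)| ≤ ∑ i, (n : ℝ) * |(v i j : ℝ)| := by
      rw [h1]
      refine (Finset.abs_sum_le_sum_abs _ _).trans (Finset.sum_le_sum fun i _ => ?_)
      rw [abs_mul, abs_of_nonneg (hx i)]
      refine mul_le_mul_of_nonneg_right ?_ (abs_nonneg _)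
      rw [← hn]
      exact Finset.single_le_sum (fun i _ => hx i) (Finset.mem_univ i)
    have h3 : ((|z j| : ℤ) : ℝ) ≤ ((B j : ℤ) : ℝ) := by simpa [B] using h2
    exact_mod_cast h3
  exact ⟨fun j => (abs_le.1 (key j)).1, fun j => (abs_le.1 (key j)).2⟩

/-- The height of a coefficient vector, as a natural number. -/
noncomputable def height (x : ι → ℝ) : ℕ := ⌊∑ i, x i⌋₊

theorem natCast_height {v : ι → Fin d → ℤ} {x : ι → ℝ} (hx : x ∈ coordLattice v)
    (hx0 : ∀ i, 0 ≤ x i) : (height x : ℝ) = ∑ i, x i := by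
  obtain ⟨m, hm⟩ := mem_intReals.1 hx.1
  have h0 : 0 ≤ ∑ i, x i := Finset.sum_nonneg fun i _ => hx0 i
  rw [height, ← hm]
  rw [← hm] at h0
  have : 0 ≤ m := by exact_mod_cast h0
  lift m to ℕ using this
  simp

theorem finite_boxPoints [Nonempty ι] {v : ι → Fin d → ℤ}
    (hv : AffineIndependent ℝ fun i => intVec (v i)) : (boxPoints v).Finite := by
  refine ((Finset.range (Fintype.card ι + 1)).finite_toSet.biUnion
    fun n _ => finite_dilatePoints hv n).subset ?_
  rintro x ⟨hx, hx'⟩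
  have hh := natCast_height hx fun i => (hx' i).1
  refine Set.mem_biUnion (x := height x) ?_ ⟨hx, fun i => (hx' i).1, hh.symm⟩
  have : (height x : ℝ) ≤ Fintype.card ι := by
    rw [hh]
    calc ∑ i, x i ≤ ∑ _i : ι, (1 : ℝ) := Finset.sum_le_sum fun i _ => (hx' i).2.le
      _ = _ := by simp
  have : height x ≤ Fintype.card ι := by exact_mod_cast this
  simpa using Nat.lt_succ_of_le this

/-- Fractional parts give a box point b and floors give a vector of natural numbers whose sum is n
minus the height of b. The dilates are thereby tiled by translates of the box. -/
theorem dilatePoints_eq_image [DecidableEq ι] [Nonempty ι] {v : ι → Fin d → ℤ}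
    (hv : AffineIndependent ℝ fun i => intVec (v i)) (n : ℕ) :
    dilatePoints v n =
      (fun p : (_ : ι → ℝ) × (ι →₀ ℕ) => fun i => p.1 i + p.2 i) ''
        ((finite_boxPoints hv).toFinset.sigma fun b =>
          if height b ≤ n then Finset.finsuppAntidiag Finset.univ (n - height b) else ∅ :
            Finset ((_ : ι → ℝ) × (ι →₀ ℕ))) := by
  ext x
  simp only [Set.mem_image, Finset.mem_coe, Finset.mem_sigma, Set.Finite.mem_toFinset]
  constructor
  · rintro ⟨hx, hx0, hn⟩
    have hb : (fun i => Int.fract (x i)) ∈ coordLattice v := fract_mem_coordLattice hx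
    have hh := natCast_height hb fun i => Int.fract_nonneg (x i)
    have hfl : ∀ i, x i = Int.fract (x i) + (⌊x i⌋₊ : ℝ) := fun i => by
      rw [natCast_floor_eq_intCast_floor (hx0 i), Int.fract_add_floor]
    have hsum : (height fun i => Int.fract (x i)) + ∑ i, ⌊x i⌋₊ = n := by
      have : (((height fun i => Int.fract (x i)) + ∑ i, ⌊x i⌋₊ : ℕ) : ℝ) = n := by
        push_cast
        rw [hh, ← hn, ← Finset.sum_add_distrib]
        exact Finset.sum_congr rfl fun i _ => (hfl i).symm
      exact_mod_cast this
    refine ⟨⟨fun i => Int.fract (x i), Finsupp.equivFunOnFinite.symm fun i => ⌊x i⌋₊⟩,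
      ⟨⟨hb, fun i => ⟨Int.fract_nonneg _, Int.fract_lt_one _⟩⟩, ?_⟩, ?_⟩
    · dsimp only
      rw [if_pos (by omega), Finset.mem_finsuppAntidiag]
      refine ⟨?_, Finset.subset_univ _⟩
      simp only [Finsupp.equivFunOnFinite_symm_apply_apply]
      omega
    · funext i
      simpa using (hfl i).symm
  · rintro ⟨⟨b, m⟩, ⟨⟨hb, hb'⟩, hm⟩, rfl⟩
    have hh := natCast_height hb fun i => (hb' i).1
    dsimp only at hm hh ⊢
    split_ifs at hm with hle
    · rw [Finset.mem_finsuppAntidiag] at hm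
      refine ⟨add_mem hb (intVectors_le_coordLattice v fun i => natCast_mem _ _),
        fun i => add_nonneg (hb' i).1 (Nat.cast_nonneg _), ?_⟩
      rw [Finset.sum_add_distrib, ← hh, ← Nat.cast_sum]
      have h1 := hm.1
      rw [h1]
      norm_cast
      omega
    · simp at hm

theorem ncard_dilatePoints [DecidableEq ι] [Nonempty ι] {v : ι → Fin d → ℤ}
    (hv : AffineIndependent ℝ fun i => intVec (v i)) (n : ℕ) :
    (dilatePoints v n).ncard = ∑ b ∈ (finite_boxPoints hv).toFinset,
      if height b ≤ n then (Finset.finsuppAntidiag (Finset.univ : Finset ι) (n - height b)).card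
        else 0 := by
  rw [dilatePoints_eq_image hv, Set.InjOn.ncard_image, Set.ncard_coe_finset, Finset.card_sigma]
  · refine Finset.sum_congr rfl fun b _ => ?_
    split_ifs <;> simp
  · rintro ⟨b, m⟩ hb ⟨b', m'⟩ hb' h
    simp only [Finset.mem_coe, Finset.mem_sigma, Set.Finite.mem_toFinset] at hb hb'
    have hbb : b = b' := by
      funext i
      have h1 := congrArg Int.fract (congrFun h i)
      simp only [Int.fract_add_natCast] at h1
      rwa [Int.fract_eq_self.2 (hb.1.2 i), Int.fract_eq_self.2 (hb'.1.2 i)] at h1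
    subst hbb
    have hmm : m = m' := by
      ext i
      have h1 := congrFun h i
      simpa using h1
    rw [hmm]

end Coordinates

/-! ### From counts in dilates to the δ-polynomial. -/

theorem coeff_mk_one_pow (d n : ℕ) :
    PowerSeries.coeff n ((PowerSeries.mk 1 : PowerSeries ℤ) ^ (d + 1)) =
      (Finset.finsuppAntidiag (Finset.univ : Finset (Fin (d + 1))) n).card := by
  have : (PowerSeries.mk 1 : PowerSeries ℤ) ^ (d + 1) =
      ∏ _i : Fin (d + 1), (PowerSeries.mk 1 : PowerSeries ℤ) := by simp
  rw [this, PowerSeries.coeff_prod]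
  simp

/-- A box point of height h contributes t^h / (1 − t)^(d+1), the power of `PowerSeries.mk 1`
standing for the inverse of (1 − t)^(d+1). -/
theorem ehrhartSeries_eq {d : ℕ} {v : Fin (d + 1) → Fin d → ℤ}
    (hv : AffineIndependent ℝ fun i => intVec (v i)) :
    ehrhartSeries (convexHull ℝ (Set.range fun i => intVec (v i))) =
      ∑ b ∈ (finite_boxPoints hv).toFinset,
        PowerSeries.X ^ height b * (PowerSeries.mk 1 : PowerSeries ℤ) ^ (d + 1) := by
  have hcount : ∀ n, (latticePointCount (convexHull ℝ (Set.range fun i => intVec (v i))) n : ℤ) =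
      PowerSeries.coeff n (∑ b ∈ (finite_boxPoints hv).toFinset,
        PowerSeries.X ^ height b * (PowerSeries.mk 1 : PowerSeries ℤ) ^ (d + 1)) := by
    intro n
    rw [latticePointCount_eq_ncard hv, ncard_dilatePoints hv, map_sum, Nat.cast_sum]
    refine Finset.sum_congr rfl fun b _ => ?_
    rw [PowerSeries.coeff_X_pow_mul', coeff_mk_one_pow]
    push_cast
    rfl
  ext n
  rw [← hcount, ehrhartSeries, PowerSeries.coeff_mk]
  split_ifs with hn
  -- The constant term of `ehrhartSeries` is 1 by convention; it agrees with the count because the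
  -- zeroth dilate is {0}.
  · subst hn
    have : {x : Fin d → ℤ | intVec x ∈
        ((0 : ℕ) : ℝ) • convexHull ℝ (Set.range fun i => intVec (v i))} = {0} := by
      rw [Nat.cast_zero, Set.zero_smul_set ((Set.range_nonempty _).mono (subset_convexHull ℝ _))]
      ext x
      simp only [Set.mem_ofPred_eq, Set.mem_zero, Set.mem_singleton_iff]
      rw [show (0 : Fin d → ℝ) = intVec 0 by funext i; simp [intVec]]
      exact intVec_injective.eq_iff
    rw [latticePointCount, this]
    simp
  · rfl

/-- The `δ`-polynomial of a lattice simplex counts the lattice points of the half-open fundamental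
parallelepiped by height. -/
theorem card_boxPoints_height {d : ℕ} {v : Fin (d + 1) → Fin d → ℤ}
    (hv : AffineIndependent ℝ fun i => intVec (v i)) {f : ℤ[X]}
    (hf : IsDeltaPolynomial (convexHull ℝ (Set.range fun i => intVec (v i))) f) (j : ℕ) :
    ((((finite_boxPoints hv).toFinset.filter fun b => height b = j).card : ℕ) : ℤ) = f.coeff j := by
  have h1 : (f : PowerSeries ℤ) =
      ∑ b ∈ (finite_boxPoints hv).toFinset, PowerSeries.X ^ height b := by
    rw [hf, ehrhartSeries_eq hv, Finset.mul_sum]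
    refine Finset.sum_congr rfl fun b _ => ?_
    rw [mul_left_comm, ← mul_pow, mul_comm (1 - _), PowerSeries.mk_one_mul_one_sub_eq_one, one_pow,
      mul_one]
  rw [← Polynomial.coeff_coe, h1, map_sum]
  simp only [PowerSeries.coeff_X_pow, Finset.sum_boole, eq_comm]

theorem coeff_sum_X_pow_mul (N K j : ℕ) (hK : 0 < K) :
    (∑ i ∈ Finset.range N, (Polynomial.X : ℤ[X]) ^ (i * K)).coeff j =
      if ∃ i < N, j = i * K then 1 else 0 := by
  simp only [Polynomial.finsetSum_coeff, Polynomial.coeff_X_pow]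
  split_ifs with h
  · obtain ⟨i, hi, rfl⟩ := h
    rw [Finset.sum_eq_single i]
    · simp
    · intro b _ hb
      rw [if_neg]
      intro h
      exact hb (Nat.eq_of_mul_eq_mul_right hK h).symm
    · simp [hi]
  · refine Finset.sum_eq_zero fun i hi => if_neg fun hj => h ⟨i, Finset.mem_range.1 hi, hj⟩

/-! ### The coefficient lattice determines the simplex. -/

section Equivalence

variable {d : ℕ}

/-- The affine basis formed by the vertices of a lattice simplex. -/
noncomputable def vertexBasis {v : Fin (d + 1) → Fin d → ℤ}
    (hv : AffineIndependent ℝ fun i => intVec (v i)) :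
    AffineBasis (Fin (d + 1)) ℝ (Fin d → ℝ) :=
  ⟨fun i => intVec (v i), hv, by
    rw [hv.affineSpan_eq_top_iff_card_eq_finrank_add_one]; simp⟩

theorem sum_coord_smul_intVec {v : Fin (d + 1) → Fin d → ℤ}
    (hv : AffineIndependent ℝ fun i => intVec (v i)) (x : Fin d → ℝ) :
    ∑ i, (vertexBasis hv).coord i x • intVec (v i) = x :=
  (vertexBasis hv).linear_combination_coord_eq_self x

theorem coord_intVec_mem {v : Fin (d + 1) → Fin d → ℤ}
    (hv : AffineIndependent ℝ fun i => intVec (v i)) (z : Fin d → ℤ) :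
    (fun i => (vertexBasis hv).coord i (intVec z)) ∈ coordLattice v := by
  refine ⟨?_, fun j => ?_⟩
  · rw [(vertexBasis hv).sum_coord_apply_eq_one]
    exact one_mem _
  · rw [← sum_smul_intVec_apply v (fun i => (vertexBasis hv).coord i (intVec z)),
      sum_coord_smul_intVec]
    exact intVec_apply_mem z j

theorem exists_matrix_of_integral (f : (Fin d → ℝ) →ᵃ[ℝ] (Fin d → ℝ))
    (hf : ∀ (z : Fin d → ℤ) (i : Fin d), f (intVec z) i ∈ intReals) :
    ∃ (U : Matrix (Fin d) (Fin d) ℤ) (t : Fin d → ℤ),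
      ∀ x, f x = x ᵥ* U.map (Int.cast : ℤ → ℝ) + intVec t := by
  have h0 : (0 : Fin d → ℝ) = intVec 0 := by funext i; simp [intVec]
  have h1 : ∀ k : Fin d, (Pi.single k 1 : Fin d → ℝ) = intVec (Pi.single k 1) := fun k => by
    funext i
    by_cases h : i = k
    · subst h; simp [intVec]
    · simp [intVec, h]
  obtain ⟨t, ht⟩ := exists_intVec_eq (x := f 0) fun i => h0 ▸ hf 0 i
  have hlin : ∀ x, f.linear x = f x - f 0 := fun x => by
    have := f.linearMap_vsub x 0
    simpa using this
  choose U hU using fun k : Fin d => exists_intVec_eq (x := f.linear (Pi.single k 1)) fun i => by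
    rw [hlin, Pi.sub_apply]
    refine sub_mem ?_ (h0 ▸ hf 0 i)
    rw [h1]
    exact hf _ i
  refine ⟨Matrix.of U, t, fun x => ?_⟩
  rw [ht, ← sub_eq_iff_eq_add, ← hlin]
  conv_lhs => rw [pi_eq_sum_univ' x, map_sum]
  funext i
  rw [Finset.sum_apply]
  simp only [Matrix.vecMul, dotProduct]
  refine Finset.sum_congr rfl fun k _ => ?_
  rw [map_smul, ← hU]
  simp [intVec]

/-- All real multiples of an affine dependence of `w` lie in its lattice, hence in that of `v`. A
real number whose multiples are all integers is 0, so the same vector is a dependence of `v` and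
vanishes. -/
theorem affineIndependent_of_coordLattice_le {v w : Fin (d + 1) → Fin d → ℤ}
    (hv : AffineIndependent ℝ fun i => intVec (v i)) (h : coordLattice w ≤ coordLattice v) :
    AffineIndependent ℝ fun i => intVec (w i) := by
  rw [affineIndependent_iff]
  intro s c hc hc' i hi
  let x : Fin (d + 1) → ℝ := fun i => if i ∈ s then c i else 0
  have hx : ∀ r : ℝ, (fun i => r * x i) ∈ coordLattice v := fun r => by
    refine h ⟨?_, fun j => ?_⟩
    · rw [← Finset.mul_sum]
      simp [x, hc, zero_mem]
    · have := congrFun hc' j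
      simp only [Finset.sum_apply, Pi.smul_apply, smul_eq_mul, Pi.zero_apply] at this
      simp only [mul_assoc, ← Finset.mul_sum]
      have h2 : ∑ i, x i * (w i j : ℝ) = 0 := by
        rw [← this]
        simp [x, intVec, ite_mul, Finset.sum_ite_mem]
      rw [h2, mul_zero]
      exact zero_mem _
  have key : ∀ s : ℝ, (∀ r : ℝ, r * s ∈ intReals) → s = 0 := by
    intro s hs
    by_contra hs0
    -- This multiplier would make 1/2 an integer.
    obtain ⟨n, hn⟩ := mem_intReals.1 (hs (1 / 2 * s⁻¹))
    rw [mul_assoc, inv_mul_cancel₀ hs0] at hn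
    have : (2 * n : ℤ) = 1 := by
      have : (2 * n : ℝ) = 1 := by rw [hn]; norm_num
      exact_mod_cast this
    omega
  have h1 : x = 0 := by
    refine hv.coeff_unique (y := 0) ?_ ?_
    · rw [key (∑ i, x i) fun r => by rw [Finset.mul_sum]; exact (hx r).1]
      simp
    · funext j
      rw [sum_smul_intVec_apply,
        key (∑ i, x i * v i j) fun r => by simpa [Finset.mul_sum, mul_assoc] using (hx r).2 j]
      simp
  simpa [x, hi] using congrFun h1 i

theorem image_convexHull_range {E F ι : Type*} [AddCommGroup E] [Module ℝ E] [AddCommGroup F]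
    [Module ℝ F] (f : E →ᵃ[ℝ] F) (u : ι → E) :
    f '' convexHull ℝ (Set.range u) = convexHull ℝ (Set.range fun i => f (u i)) := by
  rw [f.image_convexHull, ← Set.range_comp]
  rfl

/-- The affine map sending v_i to w_i keeps barycentric coordinates. Those of a lattice point lie in
the common lattice, so its image is again a lattice point. The same holds with `v` and `w`
exchanged, so the matrix is integral with an integral inverse. -/
theorem unimodularlyEquivalent_of_coordLattice_eq {v w : Fin (d + 1) → Fin d → ℤ}
    (hv : AffineIndependent ℝ fun i => intVec (v i)) (h : coordLattice v = coordLattice w) :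
    UnimodularlyEquivalent (convexHull ℝ (Set.range fun i => intVec (v i)))
      (convexHull ℝ (Set.range fun i => intVec (w i))) := by
  have hw := affineIndependent_of_coordLattice_le hv h.ge
  have transfer : ∀ {v w : Fin (d + 1) → Fin d → ℤ}
      (hv : AffineIndependent ℝ fun i => intVec (v i)), coordLattice v = coordLattice w →
      ∃ f : (Fin d → ℝ) →ᵃ[ℝ] (Fin d → ℝ),
        (∀ x, f x = ∑ i, (vertexBasis hv).coord i x • intVec (w i)) ∧
        ∃ (U : Matrix (Fin d) (Fin d) ℤ) (t : Fin d → ℤ),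
          ∀ x, f x = x ᵥ* U.map (Int.cast : ℤ → ℝ) + intVec t := by
    intro v w hv h
    let f := (Fintype.linearCombination ℝ (fun i => intVec (w i))).toAffineMap.comp
      (vertexBasis hv).coords
    have hf : ∀ x, f x = ∑ i, (vertexBasis hv).coord i x • intVec (w i) := fun x => by
      simp [f, Fintype.linearCombination_apply]
    refine ⟨f, hf, exists_matrix_of_integral f fun z i => ?_⟩
    rw [hf, sum_smul_intVec_apply]
    exact (h ▸ coord_intVec_mem hv z).2 i
  obtain ⟨f, hf, U, t, hU⟩ := transfer hv h
  obtain ⟨g, hg, U', t', hU'⟩ := transfer hw h.symm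
  have hfg : ∀ x, f (g x) = x := fun x => by
    have : (fun i => (vertexBasis hv).coord i (g x)) = fun i => (vertexBasis hw).coord i x := by
      refine hv.coeff_unique ?_ ?_
      · rw [AffineBasis.sum_coord_apply_eq_one, AffineBasis.sum_coord_apply_eq_one]
      · rw [sum_coord_smul_intVec, hg]
    rw [hf, show (∑ i, (vertexBasis hv).coord i (g x) • intVec (w i)) =
      ∑ i, (vertexBasis hw).coord i x • intVec (w i) from
        Finset.sum_congr rfl fun i _ => by rw [congrFun this i], sum_coord_smul_intVec]
  refine ⟨rfl, U, t, ?_, ?_⟩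
  · have hmul : ∀ x : Fin d → ℝ, x ᵥ* (U' * U).map (Int.cast : ℤ → ℝ) = x := by
      have hmm : (U' * U).map (Int.cast : ℤ → ℝ) =
          U'.map (Int.cast : ℤ → ℝ) * U.map (Int.cast : ℤ → ℝ) :=
        Matrix.map_mul (f := Int.castRingHom ℝ)
      intro x
      have h1 := hfg x
      have h2 := hfg 0
      rw [hU, hU', Matrix.add_vecMul] at h1 h2
      rw [Matrix.zero_vecMul, Matrix.zero_vecMul, zero_add] at h2
      rw [hmm, ← Matrix.vecMul_vecMul]
      rw [add_assoc, h2, add_zero] at h1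
      exact h1
    have h1 : U' * U = 1 := by
      ext i j
      have := congrFun (hmul (Pi.single i 1)) j
      rw [Matrix.single_one_vecMul] at this
      simp only [Matrix.row_apply, Matrix.map_apply] at this
      rw [Matrix.one_apply]
      split_ifs with hij
      · subst hij
        simpa using this
      · rw [Pi.single_apply, if_neg (Ne.symm hij)] at this
        exact_mod_cast this
    have h2 : U'.det * U.det = 1 := by rw [← Matrix.det_mul, h1, Matrix.det_one]
    exact Int.isUnit_iff.1 (IsUnit.of_mul_eq_one_right _ h2)
  · have h1 : (fun (x : Fin d → ℝ) (i : Fin d) =>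
        (x ᵥ* U.map (Int.cast : ℤ → ℝ) + intVec t) (Fin.cast rfl i)) = f := by
      funext x i
      rw [hU]
      rfl
    rw [h1, image_convexHull_range]
    congr 2
    funext i
    rw [hf]
    have : (fun j => (vertexBasis hv).coord j (intVec (v i))) = Pi.single i 1 := by
      funext j
      have := (vertexBasis hv).coord_apply j i
      rw [Pi.single_apply]
      exact this
    simp [congrFun this, Pi.single_apply, ite_smul]

theorem unimodularlyEquivalent_of_permuted_coordLattice {v w : Fin (d + 1) → Fin d → ℤ}
    (hv : AffineIndependent ℝ fun i => intVec (v i)) (σ : Equiv.Perm (Fin (d + 1)))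
    (h : ∀ x, x ∈ coordLattice w ↔ (fun i => x (σ i)) ∈ coordLattice v) :
    UnimodularlyEquivalent (convexHull ℝ (Set.range fun i => intVec (v i)))
      (convexHull ℝ (Set.range fun i => intVec (w i))) := by
  have hr : (Set.range fun i => intVec (w i)) = Set.range fun i => intVec (w (σ i)) :=
    (σ.surjective.range_comp fun i => intVec (w i)).symm
  rw [hr]
  refine unimodularlyEquivalent_of_coordLattice_eq (w := fun i => w (σ i)) hv ?_
  ext x
  have h1 := h fun i => x (σ.symm i)
  simp only [Equiv.symm_apply_apply] at h1
  rw [← h1, mem_coordLattice, mem_coordLattice, Equiv.sum_comp σ.symm x]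
  refine and_congr_right fun _ => forall_congr' fun j => ?_
  rw [← Equiv.sum_comp σ fun i => x (σ.symm i) * (w i j : ℝ)]
  simp

end Equivalence

/-! ### An integral barycentric coordinate makes the simplex a lattice pyramid. -/

section Pyramid

theorem det_transpose_toMatrix_basisFun {n : ℕ} (B : Module.Basis (Fin n) ℤ (Fin n → ℤ)) :
    (B.toMatrix (Pi.basisFun ℤ (Fin n)))ᵀ.det = 1 ∨
      (B.toMatrix (Pi.basisFun ℤ (Fin n)))ᵀ.det = -1 := by
  rw [Matrix.det_transpose]
  refine Int.isUnit_iff.1 (IsUnit.of_mul_eq_one ((Pi.basisFun ℤ (Fin n)).toMatrix B).det ?_)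
  rw [← Matrix.det_mul, Module.Basis.toMatrix_mul_toMatrix_flip, Matrix.det_one]

theorem intVec_vecMul_toMatrix {n : ℕ} (B : Module.Basis (Fin n) ℤ (Fin n → ℤ)) (z : Fin n → ℤ) :
    intVec z ᵥ* ((B.toMatrix (Pi.basisFun ℤ (Fin n)))ᵀ).map (Int.cast : ℤ → ℝ) =
      intVec (B.repr z) := by
  have h := (Pi.basisFun ℤ (Fin n)).toMatrix_mulVec_repr B z
  rw [← Matrix.vecMul_transpose] at h
  rw [← h]
  funext i
  simp [intVec, Matrix.vecMul, dotProduct]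

/-- An integral basis whose last vector is `y`, completing a basis of the kernel of an integral
functional with value `1` at `y`. -/
theorem exists_basis_last {n : ℕ} (ℓ : (Fin n → ℤ) →ₗ[ℤ] ℤ) (y : Fin n → ℤ) (hy : ℓ y = 1) :
    ∃ (m : ℕ) (B : Module.Basis (Fin (m + 1)) ℤ (Fin n → ℤ)),
      B (Fin.last m) = y ∧ ∀ z, B.repr z (Fin.last m) = ℓ z := by
  obtain ⟨m, ⟨b⟩⟩ := Submodule.nonempty_basis_of_pid (Pi.basisFun ℤ (Fin n)) (LinearMap.ker ℓ)
  let B₀ := Module.Basis.mkFinCons y b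
    (fun c x hx h => by
      have := congrArg ℓ h
      rwa [map_add, map_smul, hy, LinearMap.mem_ker.1 hx, add_zero, map_zero, smul_eq_mul,
        mul_one] at this)
    (fun z => ⟨-ℓ z, by
      rw [LinearMap.mem_ker, map_add, map_smul, hy, smul_eq_mul, mul_one, add_neg_cancel]⟩)
  have h0 : B₀ 0 = y := by simp [B₀]
  have hs : ∀ i : Fin m, ℓ (B₀ i.succ) = 0 := fun i => by
    have : B₀ i.succ = b i := by simp [B₀]
    rw [this]
    exact (b i).2
  -- `Module.Basis.mkFinCons` puts `y` first, whereas the apex of a pyramid uses the last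
  -- coordinate; the order is reversed.
  let B := B₀.reindex Fin.revPerm
  have hB : ∀ i, B i = B₀ i.rev := fun i => by simp [B]
  refine ⟨m, B, by rw [hB, Fin.rev_last, h0], fun z => ?_⟩
  conv_rhs => rw [← B.sum_repr z, map_sum]
  rw [Fin.sum_univ_castSucc]
  have : ∀ i : Fin m, ℓ (B.repr z i.castSucc • B i.castSucc) = 0 := fun i => by
    rw [map_smul, hB, Fin.rev_castSucc, hs, smul_zero]
  simp only [this]
  rw [map_smul, hB, Fin.rev_last, h0, hy]
  simp

/-- The embedding of `ℝ^n` into `ℝ^(n+1)` as the hyperplane of vanishing last coordinate. -/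
def snocZero (n : ℕ) : (Fin n → ℝ) →ₗ[ℝ] (Fin (n + 1) → ℝ) where
  toFun x := Fin.snoc x 0
  map_add' x y := by
    funext i
    refine Fin.lastCases ?_ (fun i => ?_) i <;> simp
  map_smul' c x := by
    funext i
    refine Fin.lastCases ?_ (fun i => ?_) i <;> simp

theorem latticePyramid_convexHull {n : ℕ} {ι : Type*} (u : ι → Fin n → ℝ) :
    latticePyramid (convexHull ℝ (Set.range u)) =
      convexHull ℝ ((Set.range fun i => (Fin.snoc (u i) 0 : Fin (n + 1) → ℝ)) ∪
        {Pi.single (Fin.last n) 1}) := by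
  have h : (fun x : Fin n → ℝ => (Fin.snoc x 0 : Fin (n + 1) → ℝ)) = snocZero n := rfl
  rw [latticePyramid, h, (snocZero n).image_convexHull, convexHull_convexHull_union_left, ← Set.range_comp]
  rfl

/-- The i-th barycentric coordinate is then integral on ℤ^d, so v_i and the opposite facet lie in
adjacent lattice hyperplanes. After moving another vertex v_j to the origin, v_i − v_j together with
a basis of the kernel of this functional is an integral basis, in which v_i is the apex. -/
theorem isLatticePyramid_of_coord_integral {d : ℕ} {v : Fin (d + 1) → Fin d → ℤ}
    (hv : AffineIndependent ℝ fun i => intVec (v i)) (hd : 0 < d) (i : Fin (d + 1))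
    (hi : ∀ x ∈ coordLattice v, x i ∈ intReals) :
    IsLatticePyramid (convexHull ℝ (Set.range fun i => intVec (v i))) := by
  obtain ⟨n, rfl⟩ : ∃ n, d = n + 1 := ⟨d - 1, by omega⟩
  let j : Fin (n + 1 + 1) := i.succAbove 0
  have hji : j ≠ i := Fin.succAbove_ne i 0
  have hcoord : ∀ a b, (vertexBasis hv).coord a (intVec (v b)) = if a = b then 1 else 0 :=
    fun a b => (vertexBasis hv).coord_apply a b
  let c := ((vertexBasis hv).coord i).linear
  have hc : ∀ x y, c (x - y) = (vertexBasis hv).coord i x - (vertexBasis hv).coord i y :=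
    fun x y => ((vertexBasis hv).coord i).linearMap_vsub x y
  have hsub : ∀ y z : Fin (n + 1) → ℤ, intVec (y - z) = intVec y - intVec z := fun y z => by
    funext k; simp [intVec]
  have hint : ∀ z, ∃ m : ℤ, (m : ℝ) = c (intVec z) := fun z => by
    -- Barycentric coordinates are affine. Writing z as a difference with v_j, where the i-th one
    -- vanishes, reads off the linear part.
    rw [← mem_intReals, show z = (z + v j) - v j by abel, hsub, hc, hcoord, if_neg hji.symm,
      sub_zero]
    exact hi _ (coord_intVec_mem hv _)
  choose l hl using hint
  let ℓ : (Fin (n + 1) → ℤ) →ₗ[ℤ] ℤ :=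
    { toFun := l
      map_add' := fun x y => by
        have : intVec (x + y) = intVec x + intVec y := by funext k; simp [intVec]
        have h : ((l (x + y) : ℤ) : ℝ) = ((l x + l y : ℤ) : ℝ) := by
          push_cast
          rw [hl, hl, hl, this, map_add]
        exact_mod_cast h
      map_smul' := fun m x => by
        have : intVec (m • x) = (m : ℝ) • intVec x := by funext k; simp [intVec]
        have h : ((l (m • x) : ℤ) : ℝ) = ((m * l x : ℤ) : ℝ) := by
          push_cast
          rw [hl, hl, this, map_smul, smul_eq_mul]
        simpa using (by exact_mod_cast h : l (m • x) = m * l x) }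
  have hℓ : ∀ r, ((ℓ (v r - v j) : ℤ) : ℝ) = if i = r then 1 else 0 := fun r => by
    change ((l (v r - v j) : ℤ) : ℝ) = _
    rw [hl, hsub, hc, hcoord, hcoord, if_neg hji.symm, sub_zero]
  obtain ⟨m, B, hBy, hBl⟩ := exists_basis_last ℓ (v i - v j) (by
    have := hℓ i
    rw [if_pos rfl] at this
    exact_mod_cast this)
  obtain rfl : m = n := by
    have := Module.finrank_eq_card_basis B
    simp at this
    omega
  let U := (B.toMatrix (Pi.basisFun ℤ (Fin (m + 1))))ᵀ
  let t : Fin (m + 1) → ℤ := fun k => -B.repr (v j) k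
  let f : (Fin (m + 1) → ℝ) →ᵃ[ℝ] (Fin (m + 1) → ℝ) :=
    (U.map (Int.cast : ℤ → ℝ)).vecMulLinear.toAffineMap + AffineMap.const ℝ _ (intVec t)
  have hf : ∀ x, f x = x ᵥ* U.map (Int.cast : ℤ → ℝ) + intVec t := fun x => rfl
  have hfv : ∀ r, f (intVec (v r)) = intVec (B.repr (v r - v j)) := fun r => by
    rw [hf, intVec_vecMul_toMatrix]
    funext k
    simp [intVec, t, sub_eq_add_neg]
  have hlast : ∀ r, r ≠ i → B.repr (v r - v j) (Fin.last m) = 0 := fun r hr => by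
    have := hℓ r
    rw [if_neg hr.symm] at this
    rw [hBl]
    exact_mod_cast this
  let w : Fin (m + 1) → Fin m → ℤ := fun r => Fin.init (B.repr (v (i.succAbove r) - v j))
  have hw : ∀ r, f (intVec (v (i.succAbove r))) = Fin.snoc (intVec (w r)) 0 := fun r => by
    rw [hfv]
    funext k
    refine Fin.lastCases ?_ (fun k => ?_) k
    · rw [Fin.snoc_last, intVec, hlast _ (Fin.succAbove_ne i r), Int.cast_zero]
    · simp [intVec, w, Fin.init]
  have hfi : f (intVec (v i)) = Pi.single (Fin.last m) 1 := by
    rw [hfv, ← hBy, B.repr_self]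
    funext k
    by_cases hk : k = Fin.last m
    · subst hk; simp [intVec]
    · simp [intVec, hk]
  have hdet := det_transpose_toMatrix_basisFun B
  refine ⟨m, convexHull ℝ (Set.range fun r => intVec (w r)), ⟨w, ?_, rfl⟩, rfl, U, t, hdet, ?_⟩
  · have hinj : Function.Injective f := by
      have hu : IsUnit (U.map (Int.cast : ℤ → ℝ)) := by
        have h1 : IsUnit U := (Matrix.isUnit_iff_isUnit_det _).2 (Int.isUnit_iff.2 hdet)
        exact h1.map (Int.castRingHom ℝ).mapMatrix
      intro x y hxy
      rw [hf, hf] at hxy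
      exact Matrix.vecMul_injective_of_isUnit hu (add_right_cancel hxy)
    have h1 : AffineIndependent ℝ fun r => f (intVec (v (i.succAbove r))) :=
      (hv.comp_embedding (Fin.succAboveEmb i)).map' f hinj
    simp only [hw] at h1
    exact AffineIndependent.of_comp (snocZero m).toAffineMap h1
  · have h1 : (fun (x : Fin (m + 1) → ℝ) (k : Fin (m + 1)) =>
        (x ᵥ* U.map (Int.cast : ℤ → ℝ) + intVec t) (Fin.cast rfl k)) = f := rfl
    rw [h1, image_convexHull_range, latticePyramid_convexHull]
    congr 1
    ext x
    simp only [Set.mem_union, Set.mem_range, Set.mem_singleton_iff]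
    constructor
    · rintro (⟨r, rfl⟩ | rfl)
      · exact ⟨i.succAbove r, hw r⟩
      · exact ⟨i, hfi⟩
    · rintro ⟨r, rfl⟩
      rcases eq_or_ne r i with rfl | hr
      · exact Or.inr hfi
      · obtain ⟨s, rfl⟩ := Fin.exists_succAbove_eq hr
        exact Or.inl ⟨s, (hw s).symm⟩

end Pyramid

/-! ### Subadditive bijective height functions on groups of order pq. -/

section HeightFunction

/-- By strong induction, a value smaller than i is already taken. This turns the upper bounds from
subadditivity into equalities. -/
theorem eq_self_of_injOn_of_le {f : ℕ → ℕ} {n : ℕ} (hinj : Set.InjOn f (Set.Iio n))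
    (hle : ∀ i < n, f i ≤ i) : ∀ i < n, f i = i := by
  intro i
  induction i using Nat.strong_induction_on with
  | _ i ih =>
    intro hi
    by_contra hne
    have hlt : f i < i := lt_of_le_of_ne (hle i hi) hne
    exact hne (hinj (hlt.trans hi) hi (ih _ hlt (hlt.trans hi)))

variable {G : Type*} [AddCommGroup G] {h : G → ℕ}

theorem height_nsmul_le (h0 : h 0 = 0) (hadd : ∀ a b, h (a + b) ≤ h a + h b) (a : G) (n : ℕ) :
    h (n • a) ≤ n * h a := by
  induction n with
  | zero => simp [h0]
  | succ n ih =>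
    rw [succ_nsmul, add_mul, one_mul]
    exact (hadd _ _).trans (by omega)

/-- If the element of height one has prime order `q`, then the element of height `q` generates the
group modulo its multiples, and heights are additive on both. -/
theorem exists_generators_of_addOrderOf_eq {p q : ℕ} (hp : p.Prime) (hq : q.Prime)
    (hinj : Function.Injective h) (hsurj : ∀ j < p * q, ∃ g, h g = j)
    (hadd : ∀ a b, h (a + b) ≤ h a + h b) (h0 : h 0 = 0) {α : G} (hα : h α = 1)
    (hord : addOrderOf α = q) (hcard : Nat.card G = p * q) :
    ∃ β : G, q • α = 0 ∧ p • β ∈ AddSubgroup.zmultiples α ∧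
      ∀ m < p, ∀ l < q, h (m • β + l • α) = m * q + l := by
  have hq0 := hq.pos
  have hp1 := hp.one_lt
  have hαinj : ∀ l < q, ∀ l' < q, l • α = l' • α → l = l' := fun l hl l' hl' he => by
    have := (nsmul_inj_mod (x := α)).1 he
    rwa [hord, Nat.mod_eq_of_lt hl, Nat.mod_eq_of_lt hl'] at this
  have hlα : ∀ l < q, h (l • α) = l := by
    refine eq_self_of_injOn_of_le (f := fun l => h (l • α)) ?_ fun l _ => ?_
    · intro l hl l' hl' he
      exact hαinj l hl l' hl' (hinj he)
    · simpa [hα] using height_nsmul_le h0 hadd α l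
  -- The multiples of `α` use up the heights 0, …, q − 1, so an element of height q lies outside
  -- them.
  obtain ⟨β, hβ⟩ := hsurj q (by nlinarith)
  have hmem : ∀ g ∈ AddSubgroup.zmultiples α, h g < q := fun g hg => by
    have hfin : IsOfFinAddOrder α := addOrderOf_pos_iff.1 (by omega)
    obtain ⟨n, rfl⟩ := hfin.mem_multiples_iff_mem_zmultiples.2 hg
    change h (n • α) < q
    rw [← mod_addOrderOf_nsmul, hord, hlα _ (Nat.mod_lt _ hq0)]
    exact Nat.mod_lt _ hq0
  have hβα : β ∉ AddSubgroup.zmultiples α := fun hmem' => by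
    have := hmem β hmem'
    omega
  have hpβ : p • β ∈ AddSubgroup.zmultiples α := by
    have h1 := AddSubgroup.card_eq_card_quotient_mul_card_addSubgroup (AddSubgroup.zmultiples α)
    rw [hcard, Nat.card_zmultiples, hord] at h1
    have h2 : Nat.card (G ⧸ AddSubgroup.zmultiples α) = p :=
      (Nat.eq_of_mul_eq_mul_right hq0 h1).symm
    rw [← QuotientAddGroup.eq_zero_iff, QuotientAddGroup.mk_nsmul, ← h2]
    exact card_nsmul_eq_zero'
  have hβinj : ∀ m m', m ≤ m' → m' < p → (m' - m) • β ∈ AddSubgroup.zmultiples α → m = m' := by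
    intro m m' hle hm' hmm
    -- A nonzero difference below p is invertible modulo p; Bézout together with `hpβ` would put `β`
    -- into the multiples of `α`.
    by_contra hne
    have hcop : Nat.Coprime (m' - m) p :=
      (Nat.coprime_of_lt_prime (by omega) (by omega) hp).symm
    refine hβα ?_
    have hbez : ((m' - m : ℕ) : ℤ) * Nat.gcdA (m' - m) p + (p : ℤ) * Nat.gcdB (m' - m) p = 1 := by
      rw [← Nat.gcd_eq_gcd_ab, hcop.gcd_eq_one, Nat.cast_one]
    have : β = Nat.gcdA (m' - m) p • ((m' - m) • β) + Nat.gcdB (m' - m) p • (p • β) := by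
      rw [← natCast_zsmul β (m' - m), ← natCast_zsmul β p, smul_smul, smul_smul, ← add_smul,
        mul_comm, mul_comm _ (p : ℤ), hbez, one_smul]
    rw [this]
    exact add_mem (zsmul_mem hmm _) (zsmul_mem hpβ _)
  -- Enumerating the combinations by base-q digits makes the subadditive bound exactly n, so
  -- `eq_self_of_injOn_of_le` applies again.
  have key : ∀ n < p * q, h ((n / q) • β + (n % q) • α) = n := by
    refine eq_self_of_injOn_of_le (f := fun n => h ((n / q) • β + (n % q) • α)) ?_ fun n _ => ?_
    · have aux : ∀ n n', n' < p * q → n / q ≤ n' / q →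
          (n / q) • β + (n % q) • α = (n' / q) • β + (n' % q) • α → n = n' := by
        intro n n' hn' hle he
        have hmm : n / q = n' / q := by
          refine hβinj _ _ hle (Nat.div_lt_of_lt_mul (by rwa [mul_comm])) ?_
          have : (n' / q - n / q) • β = (n % q) • α - (n' % q) • α := by
            rw [sub_nsmul β hle, ← sub_eq_add_neg, sub_eq_sub_iff_add_eq_add, ← he, add_comm]
          rw [this]
          exact sub_mem (AddSubgroup.nsmul_mem_zmultiples α _) (AddSubgroup.nsmul_mem_zmultiples α _)
        rw [hmm] at he
        have := hαinj _ (Nat.mod_lt _ hq0) _ (Nat.mod_lt _ hq0) (add_left_cancel he)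
        rw [← Nat.div_add_mod n q, ← Nat.div_add_mod n' q, hmm, this]
      intro n hn n' hn' he
      rcases le_total (n / q) (n' / q) with hle | hle
      · exact aux n n' hn' hle (hinj he)
      · exact (aux n' n hn hle (hinj he).symm).symm
    · refine (hadd _ _).trans ?_
      have h1 := height_nsmul_le h0 hadd β (n / q)
      rw [hβ] at h1
      rw [hlα _ (Nat.mod_lt _ hq0)]
      have := Nat.div_add_mod n q
      nlinarith
  refine ⟨β, hord ▸ addOrderOf_nsmul_eq_zero α, hpβ, fun m hm l hl => ?_⟩
  have hdiv : (m * q + l) / q = m := by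
    rw [mul_comm, Nat.mul_add_div hq0, Nat.div_eq_of_lt hl, add_zero]
  have hmod : (m * q + l) % q = l := by
    rw [mul_comm, Nat.mul_add_mod, Nat.mod_eq_of_lt hl]
  have := key (m * q + l) (by nlinarith)
  rwa [hdiv, hmod] at this

/-- Generators adapted to a subadditive bijective height function on a group of order `p * q`. -/
theorem exists_generators {p q : ℕ} (hp : p.Prime) (hq : q.Prime)
    (hinj : Function.Injective h) (hlt : ∀ g, h g < p * q) (hsurj : ∀ j < p * q, ∃ g, h g = j)
    (hadd : ∀ a b, h (a + b) ≤ h a + h b) (h0 : h 0 = 0) :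
    (∃ α : G, (p * q) • α = 0 ∧ ∀ n < p * q, h (n • α) = n) ∨
    (∃ α β : G, q • α = 0 ∧ p • β ∈ AddSubgroup.zmultiples α ∧
      ∀ m < p, ∀ l < q, h (m • β + l • α) = m * q + l) ∨
    (∃ α β : G, p • α = 0 ∧ q • β ∈ AddSubgroup.zmultiples α ∧
      ∀ m < q, ∀ l < p, h (m • β + l • α) = m * p + l) := by
  have hcard : Nat.card G = p * q := by
    rw [← Nat.card_fin (p * q)]
    refine Nat.card_eq_of_bijective (fun g => (⟨h g, hlt g⟩ : Fin (p * q))) ⟨?_, ?_⟩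
    · intro a b hab
      exact hinj (congrArg Fin.val hab)
    · rintro ⟨j, hj⟩
      obtain ⟨g, rfl⟩ := hsurj j hj
      exact ⟨g, rfl⟩
  have hN : 1 < p * q := by nlinarith [hp.one_lt, hq.one_lt]
  obtain ⟨α, hα⟩ := hsurj 1 hN
  have hdvd : addOrderOf α ∣ p * q := hcard ▸ addOrderOf_dvd_natCard α
  have hne : addOrderOf α ≠ 1 := fun h1 => by
    rw [AddMonoid.addOrderOf_eq_one_iff] at h1
    rw [h1, h0] at hα
    omega
  obtain ⟨a, b, ha, hb, hab⟩ := (Nat.dvd_mul).1 hdvd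
  rcases (Nat.dvd_prime hp).1 ha with rfl | rfl <;> rcases (Nat.dvd_prime hq).1 hb with rfl | rfl
  · exact absurd hab.symm (by simpa using hne)
  · obtain ⟨β, hβ⟩ := exists_generators_of_addOrderOf_eq hp hq hinj hsurj hadd h0 hα
      (by rw [← hab, one_mul]) hcard
    exact Or.inr (Or.inl ⟨α, β, hβ⟩)
  · rw [mul_comm] at hcard hsurj
    obtain ⟨β, hβ⟩ := exists_generators_of_addOrderOf_eq hq hp hinj
      (by simpa [mul_comm] using hsurj) hadd h0 hα (by rw [← hab, mul_one]) hcard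
    exact Or.inr (Or.inr ⟨α, β, hβ⟩)
  · refine Or.inl ⟨α, by rw [hab]; exact addOrderOf_nsmul_eq_zero α, ?_⟩
    refine eq_self_of_injOn_of_le (f := fun l => h (l • α)) ?_ fun l _ => ?_
    · intro l hl l' hl' he
      have := (nsmul_inj_mod (x := α)).1 (hinj he)
      rwa [← hab, Nat.mod_eq_of_lt hl, Nat.mod_eq_of_lt hl'] at this
    · simpa [hα] using height_nsmul_le h0 hadd α l

end HeightFunction

/-! ### From the δ-polynomial to generators of the coefficient lattice. -/

section BoxHeights

variable {d : ℕ} {v : Fin (d + 1) → Fin d → ℤ}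

/-- The heights of the box points are `0, K, …, (N - 1) K`, each attained exactly once. -/
structure HasHeights (v : Fin (d + 1) → Fin d → ℤ) (N K : ℕ) : Prop where
  exists_lt : ∀ x ∈ boxPoints v, ∃ i < N, ∑ j, x j = (i * K : ℝ)
  exists_eq : ∀ i < N, ∃ x ∈ boxPoints v, ∑ j, x j = (i * K : ℝ)
  injOn : ∀ x ∈ boxPoints v, ∀ y ∈ boxPoints v, ∑ j, x j = ∑ j, y j → x = y

theorem hasHeights_of_isDeltaPolynomial (hv : AffineIndependent ℝ fun i => intVec (v i))
    {N K : ℕ} (hK : 0 < K)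
    (hf : IsDeltaPolynomial (convexHull ℝ (Set.range fun i => intVec (v i)))
      (∑ i ∈ Finset.range N, (Polynomial.X : ℤ[X]) ^ (i * K))) : HasHeights v N K := by
  have hcard := card_boxPoints_height hv hf
  simp only [coeff_sum_X_pow_mul N K _ hK] at hcard
  have hh : ∀ x ∈ boxPoints v, (height x : ℝ) = ∑ j, x j := fun x hx =>
    natCast_height hx.1 fun i => (hx.2 i).1
  have hpos : ∀ x ∈ boxPoints v, ∃ i < N, height x = i * K := fun x hx => by
    by_contra hne
    have h1 := hcard (height x)
    rw [if_neg hne] at h1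
    have h2 : ((finite_boxPoints hv).toFinset.filter fun b => height b = height x) = ∅ := by
      rw [← Finset.card_eq_zero]; exact_mod_cast h1
    have : x ∈ ((finite_boxPoints hv).toFinset.filter fun b => height b = height x) := by
      simpa using hx
    rw [h2] at this
    simp at this
  refine ⟨fun x hx => ?_, fun i hi => ?_, fun x hx y hy hxy => ?_⟩
  · obtain ⟨i, hi, h⟩ := hpos x hx
    exact ⟨i, hi, by rw [← hh x hx, h]; push_cast; rfl⟩
  · have h1 := hcard (i * K)
    rw [if_pos ⟨i, hi, rfl⟩] at h1
    have h2 : 0 < ((finite_boxPoints hv).toFinset.filter fun b => height b = i * K).card := by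
      omega
    obtain ⟨x, hx⟩ := Finset.card_pos.1 h2
    simp only [Finset.mem_filter, Set.Finite.mem_toFinset] at hx
    exact ⟨x, hx.1, by rw [← hh x hx.1, hx.2]; push_cast; rfl⟩
  · obtain ⟨i, hi, h⟩ := hpos x hx
    have h1 := hcard (height x)
    rw [if_pos ⟨i, hi, h⟩] at h1
    have h2 : height y = height x := by
      have : (height y : ℝ) = height x := by rw [hh x hx, hh y hy, hxy]
      exact_mod_cast this
    refine Finset.card_le_one.1 (show ((finite_boxPoints hv).toFinset.filter
      fun b => height b = height x).card ≤ 1 by omega) x (by simpa using hx) y ?_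
    simpa using ⟨hy, h2⟩

theorem fract_mem_boxPoints {x : Fin (d + 1) → ℝ} (hx : x ∈ coordLattice v) :
    (fun i => Int.fract (x i)) ∈ boxPoints v :=
  ⟨fract_mem_coordLattice hx, fun _ => ⟨Int.fract_nonneg _, Int.fract_lt_one _⟩⟩

theorem eq_of_mem_boxPoints_of_sub_mem {x y : Fin (d + 1) → ℝ} (hx : x ∈ boxPoints v)
    (hy : y ∈ boxPoints v) (h : ∀ i, x i - y i ∈ intReals) : x = y := by
  funext i
  have := fract_eq_fract_iff_sub_mem.2 (h i)
  rwa [Int.fract_eq_self.2 (hx.2 i), Int.fract_eq_self.2 (hy.2 i)] at this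

/-- The coordinate lattice is generated by `α`, `β` and the integer vectors, with
`q α ∈ ℤ^(d+1)`, `p β ∈ ℤ α + ℤ^(d+1)`, and heights are additive on the multiples of `α`, `β`. -/
def HasGenerators (v : Fin (d + 1) → Fin d → ℤ) (p q K : ℕ) (α β : Fin (d + 1) → ℝ) : Prop :=
  α ∈ boxPoints v ∧ β ∈ boxPoints v ∧ (∀ i, (q : ℝ) * α i ∈ intReals) ∧
    (∃ c : ℤ, ∀ i, (p : ℝ) * β i - c * α i ∈ intReals) ∧
    (∀ m < p, ∀ l < q, ∑ i, Int.fract (m * β i + l * α i) = ((m * q + l : ℕ) * K : ℝ)) ∧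
    ∀ x ∈ coordLattice v, ∃ m l : ℕ, ∀ i, x i - (m * β i + l * α i) ∈ intReals

/-- The abstract result is applied to Λ modulo integer vectors, the height of a class being the
coordinate sum of its box point divided by K; the conclusions are then read back on box points. -/
theorem HasHeights.exists_generators {p q K : ℕ} (hp : p.Prime) (hq : q.Prime) (hK : 0 < K)
    (H : HasHeights v (p * q) K) :
    (∃ α ∈ boxPoints v, (∀ i, ((p * q : ℕ) : ℝ) * α i ∈ intReals) ∧
      (∀ n < p * q, ∑ i, Int.fract (n * α i) = (n * K : ℝ)) ∧
      ∀ x ∈ coordLattice v, ∃ n : ℕ, ∀ i, x i - n * α i ∈ intReals) ∨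
    (∃ α β, HasGenerators v p q K α β) ∨ ∃ α β, HasGenerators v q p K α β := by
  let I := (intVectors (Fin (d + 1))).addSubgroupOf (coordLattice v)
  let mk : coordLattice v →+ coordLattice v ⧸ I := QuotientAddGroup.mk' I
  have hmk : ∀ x y : coordLattice v, mk x = mk y ↔
      ∀ i, (x : Fin (d + 1) → ℝ) i - (y : Fin (d + 1) → ℝ) i ∈ intReals := fun x y => by
    rw [← sub_eq_zero, ← map_sub]
    change QuotientAddGroup.mk (x - y) = 0 ↔ _
    rw [QuotientAddGroup.eq_zero_iff, AddSubgroup.mem_addSubgroupOf]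
    rfl
  have hrep : ∀ g, ∃ x : coordLattice v, (x : Fin (d + 1) → ℝ) ∈ boxPoints v ∧ mk x = g := fun g => by
    obtain ⟨x, rfl⟩ := QuotientAddGroup.mk'_surjective I g
    refine ⟨⟨_, fract_mem_coordLattice x.2⟩, fract_mem_boxPoints x.2, ?_⟩
    rw [hmk]
    intro i
    rw [← neg_sub]
    exact neg_mem (sub_fract_mem_intReals _)
  choose rep hrep hmkrep using hrep
  choose h hlt hh using fun g => H.exists_lt _ (hrep g)
  have hK' : (0 : ℝ) < K := by exact_mod_cast hK
  have hfr : ∀ x : coordLattice v,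
      (fun i => Int.fract ((x : Fin (d + 1) → ℝ) i)) = (rep (mk x) : Fin (d + 1) → ℝ) := fun x => by
    refine eq_of_mem_boxPoints_of_sub_mem (fract_mem_boxPoints x.2) (hrep _) fun i => ?_
    have h1 := (hmk (rep (mk x)) x).1 (hmkrep _) i
    have h2 := neg_mem (add_mem (sub_fract_mem_intReals ((x : Fin (d + 1) → ℝ) i)) h1)
    convert h2 using 1
    ring
  have hheight : ∀ x : coordLattice v,
      ∑ i, Int.fract ((x : Fin (d + 1) → ℝ) i) = (h (mk x) * K : ℝ) := fun x => by
    rw [← hh, ← hfr]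
  have hinj : Function.Injective h := fun a b hab => by
    have := H.injOn _ (hrep a) _ (hrep b) (by rw [hh, hh, hab])
    rw [← hmkrep a, ← hmkrep b, Subtype.ext this]
  have hbox : ∀ x : coordLattice v, (x : Fin (d + 1) → ℝ) ∈ boxPoints v →
      ∑ i, (x : Fin (d + 1) → ℝ) i = (h (mk x) * K : ℝ) := fun x hx => by
    rw [← hheight]
    exact Finset.sum_congr rfl fun i _ => (Int.fract_eq_self.2 (hx.2 i)).symm
  have hsurj : ∀ j < p * q, ∃ g, h g = j := fun j hj => by
    obtain ⟨x, hx, hxj⟩ := H.exists_eq j hj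
    refine ⟨mk ⟨x, hx.1⟩, ?_⟩
    have := (hbox ⟨x, hx.1⟩ hx).symm.trans hxj
    exact_mod_cast mul_right_cancel₀ hK'.ne' this
  have hadd : ∀ a b, h (a + b) ≤ h a + h b := fun a b => by
    have h1 : (h (a + b) * K : ℝ) ≤ (h a + h b) * K := by
      rw [add_mul]
      conv_lhs => rw [← hmkrep a, ← hmkrep b, ← map_add, ← hheight]
      rw [← hh a, ← hh b, ← Finset.sum_add_distrib]
      refine Finset.sum_le_sum fun i _ => ?_
      rw [← Int.fract_eq_self.2 ((hrep a).2 i), ← Int.fract_eq_self.2 ((hrep b).2 i)]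
      simpa using Int.fract_add_le ((rep a : Fin (d + 1) → ℝ) i) ((rep b : Fin (d + 1) → ℝ) i)
    exact_mod_cast le_of_mul_le_mul_right h1 hK'
  have h0 : h 0 = 0 := by
    have h1 := hheight 0
    rw [map_zero] at h1
    simpa [hK.ne'] using h1
  -- The primes are quantified afresh so that both noncyclic cases, which differ by exchanging them,
  -- are covered.
  have two : ∀ {p q : ℕ}, 0 < q → (∀ g, h g < p * q) →
      (∃ α β : coordLattice v ⧸ I, q • α = 0 ∧ p • β ∈ AddSubgroup.zmultiples α ∧
        ∀ m < p, ∀ l < q, h (m • β + l • α) = m * q + l) →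
      ∃ α β, HasGenerators v p q K α β := by
    rintro p q hq0 hlt ⟨α, β, hα, ⟨c, hc⟩, hml⟩
    refine ⟨rep α, rep β, hrep α, hrep β, fun i => ?_, ⟨c, fun i => ?_⟩, fun m hm l hl => ?_,
      fun x hx => ?_⟩
    · have := (hmk (q • rep α) 0).1 (by rw [map_nsmul, hmkrep, hα, map_zero]) i
      simpa using this
    · have := (hmk (p • rep β) (c • rep α)).1 (by
        rw [map_nsmul, map_zsmul, hmkrep, hmkrep]; exact hc.symm) i
      simpa using this
    · have := hheight (m • rep β + l • rep α)
      rw [map_add, map_nsmul, map_nsmul, hmkrep, hmkrep, hml m hm l hl] at this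
      simpa using this
    · let g := mk ⟨x, hx⟩
      -- The height written in base q names a combination of the generators of the same height, and
      -- heights are injective.
      refine ⟨h g / q, h g % q, fun i => ?_⟩
      have h1 : mk ⟨x, hx⟩ = mk ((h g / q) • rep β + (h g % q) • rep α) := by
        rw [map_add, map_nsmul, map_nsmul, hmkrep, hmkrep]
        refine hinj ?_
        rw [hml _ (Nat.div_lt_of_lt_mul (by rw [mul_comm]; exact hlt g)) _ (Nat.mod_lt _ hq0)]
        exact (Nat.div_add_mod' (h g) q).symm
      simpa using (hmk _ _).1 h1 i
  rcases _root_.exists_generators hp hq hinj hlt hsurj hadd h0 with ⟨α, hα, hn⟩ | h2 | h2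
  · refine Or.inl ⟨rep α, hrep α, fun i => ?_, fun n hnn => ?_, fun x hx => ?_⟩
    · have := (hmk ((p * q) • rep α) 0).1 (by rw [map_nsmul, hmkrep, hα, map_zero]) i
      simpa using this
    · have := hheight (n • rep α)
      rw [map_nsmul, hmkrep, hn n hnn] at this
      simpa using this
    · refine ⟨h (mk ⟨x, hx⟩), fun i => ?_⟩
      have h1 : mk ⟨x, hx⟩ = mk (h (mk ⟨x, hx⟩) • rep α) := by
        rw [map_nsmul, hmkrep]
        exact hinj (hn _ (hlt _)).symm
      simpa using (hmk _ _).1 h1 i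
  · exact Or.inr (Or.inl (two hq.pos hlt h2))
  · exact Or.inr (Or.inr (two hp.pos (fun g => by rw [mul_comm]; exact hlt g) h2))

/-- Taking fractional parts never increases a nonnegative term, so equal sums force equality term by
term. -/
theorem lt_one_of_sum_fract_eq {ι : Type*} [Fintype ι] {u : ι → ℝ} (hu : ∀ i, 0 ≤ u i)
    (h : ∑ i, Int.fract (u i) = ∑ i, u i) (i : ι) : u i < 1 := by
  have hle : ∀ i ∈ Finset.univ, Int.fract (u i) ≤ u i := fun i _ => by
    have h1 : (0 : ℤ) ≤ ⌊u i⌋ := Int.floor_nonneg.2 (hu i)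
    have h2 : (0 : ℝ) ≤ ⌊u i⌋ := by exact_mod_cast h1
    have := Int.self_sub_floor (u i)
    linarith
  have := (Finset.sum_eq_sum_iff_of_le hle).1 h i (Finset.mem_univ i)
  rw [← this]
  exact Int.fract_lt_one _

/-- If the integer nx were at least 2, the last bound would give x > nx − 1 ≥ 1, contradicting (n −
1)x < 1. -/
theorem eq_zero_or_eq_inv {n : ℕ} (hn : 2 ≤ n) {x : ℝ} (hx : 0 ≤ x) (hint : (n : ℝ) * x ∈ intReals)
    (hlt : ((n - 1 : ℕ) : ℝ) * x < 1) : x = 0 ∨ x = 1 / n := by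
  obtain ⟨a, ha⟩ := mem_intReals.1 hint
  have hn' : (0 : ℝ) < n := by positivity
  have hxa : x = a / n := by rw [ha]; field_simp
  have hn2 : (2 : ℝ) ≤ n := by exact_mod_cast hn
  have ha0 : 0 ≤ a := by
    have : (0 : ℝ) ≤ a := by rw [ha]; positivity
    exact_mod_cast this
  have ha2 : a < 2 := by
    by_contra! h
    have h2 : (2 : ℝ) ≤ a := by exact_mod_cast h
    rw [Nat.cast_sub (by omega), Nat.cast_one] at hlt
    have h3 : (n : ℝ) * x - x < 1 := by linarith
    rw [← ha] at h3
    have : 1 < x := by linarith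
    nlinarith
  rcases (by omega : a = 0 ∨ a = 1) with rfl | rfl
  · left; simpa using hxa
  · right; simpa using hxa

end BoxHeights

/-! ### The possible coefficient lattices. -/

section Classification

variable {d : ℕ} {v : Fin (d + 1) → Fin d → ℤ}

theorem nsmul_add_nsmul_add_mem {α β : Fin (d + 1) → ℝ} (hα : α ∈ coordLattice v)
    (hβ : β ∈ coordLattice v) {x : Fin (d + 1) → ℝ} (m l : ℤ)
    (hx : ∀ i, x i - (m * β i + l * α i) ∈ intReals) : x ∈ coordLattice v := by
  have h1 : (x - (m • β + l • α)) ∈ coordLattice v :=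
    intVectors_le_coordLattice v fun i => by simpa using hx i
  have := add_mem h1 (add_mem (zsmul_mem hβ m) (zsmul_mem hα l))
  simpa using this

/-- The height of (N − 1)α leaves no room for carries, so each coordinate of `α` is 0 or 1/N. A zero
would make that coordinate integral on Λ, against `hpyr`. The sum K then gives the dimension. -/
theorem coordLattice_cyclic {N K : ℕ} (hN : 2 ≤ N) {α : Fin (d + 1) → ℝ} (hα : α ∈ boxPoints v)
    (hint : ∀ i, (N : ℝ) * α i ∈ intReals)
    (hht : ∀ n < N, ∑ i, Int.fract (n * α i) = (n * K : ℝ))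
    (hgen : ∀ x ∈ coordLattice v, ∃ n : ℕ, ∀ i, x i - n * α i ∈ intReals)
    (hpyr : ∀ i, ∃ x ∈ coordLattice v, x i ∉ intReals) :
    d + 1 = N * K ∧
      ∀ x, x ∈ coordLattice v ↔ ∃ m : ℤ, ∀ i, x i - m * (1 / N : ℝ) ∈ intReals := by
  have hN' : (0 : ℝ) < N := by positivity
  have hsum : ∑ i, α i = K := by
    have := hht 1 (by omega)
    simpa [Int.fract_eq_self.2 (hα.2 _)] using this
  have hαi : ∀ i, α i = 1 / N := fun i => by
    have hlt := lt_one_of_sum_fract_eq (u := fun i => ((N - 1 : ℕ) : ℝ) * α i)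
      (fun i => mul_nonneg (Nat.cast_nonneg _) (hα.2 i).1)
      (by rw [hht _ (by omega), ← Finset.mul_sum, hsum]) i
    refine (eq_zero_or_eq_inv hN (hα.2 i).1 (hint i) hlt).resolve_left fun h0 => ?_
    obtain ⟨x, hx, hxi⟩ := hpyr i
    obtain ⟨n, hn⟩ := hgen x hx
    have := hn i
    rw [h0, mul_zero, sub_zero] at this
    exact hxi this
  constructor
  · simp only [hαi, Finset.sum_const, Finset.card_univ, Fintype.card_fin, nsmul_eq_mul] at hsum
    field_simp at hsum
    exact_mod_cast hsum
  · refine fun x => ⟨fun hx => ?_, fun ⟨m, hm⟩ => ?_⟩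
    · obtain ⟨n, hn⟩ := hgen x hx
      exact ⟨n, fun i => by simpa [hαi] using hn i⟩
    · exact nsmul_add_nsmul_add_mem hα.1 hα.1 m 0 fun i => by simpa [hαi] using hm i

/-- Here T is the support of `α`, where `α` equals 1/q; off T, `β` equals 1/p. On T, `β` is
constantly 1/(pq), making Λ cyclic over ℤ^(d+1), or constantly 0, making the two generators
independent. The sums of `α` and `β` give the sizes of T and its complement. -/
theorem coordLattice_two_types {p q K : ℕ} (hp : 2 ≤ p) (hq : 2 ≤ q) {α β : Fin (d + 1) → ℝ}
    (H : HasGenerators v p q K α β) (hpyr : ∀ i, ∃ x ∈ coordLattice v, x i ∉ intReals) :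
    ∃ T : Finset (Fin (d + 1)), T.card = q * K ∧
      ((d + 1 = q * K + (p * q - 1) * K ∧ ∀ x, x ∈ coordLattice v ↔
          ∃ m : ℤ, ∀ i, x i - m * (if i ∈ T then 1 / (p * q) else 1 / p : ℝ) ∈ intReals) ∨
       (d + 1 = q * K + p * q * K ∧ ∀ x, x ∈ coordLattice v ↔
          ∃ m l : ℤ, ∀ i, x i - (if i ∈ T then l / q else m / p : ℝ) ∈ intReals)) := by
  obtain ⟨hα, hβ, hqα, ⟨c, hc⟩, hht, hgen⟩ := H
  have hp' : (0 : ℝ) < p := by positivity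
  have hq' : (0 : ℝ) < q := by positivity
  have hsα : ∑ i, α i = K := by
    have := hht 0 (by omega) 1 (by omega)
    simpa [Int.fract_eq_self.2 (hα.2 _)] using this
  have hsβ : ∑ i, β i = q * K := by
    have := hht 1 (by omega) 0 (by omega)
    simpa [Int.fract_eq_self.2 (hβ.2 _)] using this
  -- The extreme combination (p − 1)β + (q − 1)α has no carries, which bounds every coordinate of
  -- both generators at once.
  have hlt := lt_one_of_sum_fract_eq
    (u := fun i => ((p - 1 : ℕ) : ℝ) * β i + ((q - 1 : ℕ) : ℝ) * α i)
    (fun i => add_nonneg (mul_nonneg (Nat.cast_nonneg _) (hβ.2 i).1)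
      (mul_nonneg (Nat.cast_nonneg _) (hα.2 i).1))
    (by
      rw [hht _ (by omega) _ (by omega), Finset.sum_add_distrib, ← Finset.mul_sum,
        ← Finset.mul_sum, hsα, hsβ]
      push_cast
      ring)
  have hα' : ∀ i, α i = 0 ∨ α i = 1 / q := fun i => by
    refine eq_zero_or_eq_inv hq (hα.2 i).1 (hqα i) ?_
    have h1 := mul_nonneg (Nat.cast_nonneg (α := ℝ) (p - 1)) (hβ.2 i).1
    have h2 := hlt i
    linarith
  have hβ0 : ∀ i, α i = 0 → β i = 1 / p := fun i hi => by
    refine (eq_zero_or_eq_inv hp (hβ.2 i).1 (by simpa [hi] using hc i) ?_).resolve_left fun h0 => ?_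
    · simpa [hi] using hlt i
    · obtain ⟨x, hx, hxi⟩ := hpyr i
      obtain ⟨m, l, hn⟩ := hgen x hx
      have := hn i
      rw [hi, h0, mul_zero, mul_zero, add_zero, sub_zero] at this
      exact hxi this
  have hβ1 : ∀ i, α i = 1 / q → β i = 0 ∨ β i = 1 / (p * q) := fun i hi => by
    have h1 : (p : ℝ) * (q * β i) ∈ intReals := by
      have := add_mem (mul_mem (natCast_mem intReals q) (hc i))
        (mul_mem (intCast_mem intReals c) (hqα i))
      convert this using 1
      ring
    -- On T the multiple of `α` already takes up 1 − 1/q, leaving less than 1/q for (p − 1)β.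
    have h2 : ((p - 1 : ℕ) : ℝ) * (q * β i) < 1 := by
      have := hlt i
      rw [hi, Nat.cast_sub (by omega : 1 ≤ q), Nat.cast_one] at this
      have h3 : ((p - 1 : ℕ) : ℝ) * β i < 1 / q := by
        have : ((q : ℝ) - 1) * (1 / q) = 1 - 1 / q := by field_simp
        linarith
      rw [lt_div_iff₀ hq'] at h3
      linarith
    rcases eq_zero_or_eq_inv hp (mul_nonneg hq'.le (hβ.2 i).1) h1 h2 with h | h
    · left
      exact (mul_eq_zero.1 h).resolve_left hq'.ne'
    · right
      field_simp
      field_simp at h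
      linarith
  have hinv : (1 / q : ℝ) ∉ intReals := fun h => by
    have h1 := fract_eq_zero_of_mem_intReals h
    have hq2 : (2 : ℝ) ≤ q := by exact_mod_cast hq
    rw [Int.fract_eq_self.2 ⟨by positivity, by rw [div_lt_one hq']; linarith⟩] at h1
    exact absurd h1 (by positivity)
  classical
  let T : Finset (Fin (d + 1)) := Finset.univ.filter fun i => α i ≠ 0
  have hT : ∀ i, i ∈ T ↔ α i ≠ 0 := fun i => by simp [T]
  have hαT : ∀ i, α i = if i ∈ T then 1 / (q : ℝ) else 0 := fun i => by
    by_cases h : α i = 0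
    · simp [hT, h]
    · rw [if_pos ((hT i).2 h)]; exact (hα' i).resolve_left h
  have hcT : T.card = q * K := by
    simp only [hαT, Finset.sum_ite_mem, Finset.univ_inter, Finset.sum_const, nsmul_eq_mul] at hsα
    field_simp at hsα
    exact_mod_cast hsα
  have hcompl : T.card + Tᶜ.card = d + 1 := by
    rw [Finset.card_add_card_compl, Fintype.card_fin]
  refine ⟨T, hcT, ?_⟩
  by_cases hex : ∃ i ∈ T, β i ≠ 0
  · left
    obtain ⟨i₀, hi₀, hβi₀⟩ := hex
    have hβT : ∀ i, β i = if i ∈ T then 1 / (p * q : ℝ) else 1 / p := fun i => by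
      split_ifs with hi
      · have hαi : α i = 1 / q := by rw [hαT, if_pos hi]
        -- Since `α` is constant on T, the relation pβ ≡ cα forces pβ to be constant modulo 1 there.
        -- The values 0 and 1/(pq) together would make 1/q an integer.
        refine (hβ1 i hαi).resolve_left fun h0 => hinv ?_
        have hαi₀ : α i₀ = 1 / q := by rw [hαT, if_pos hi₀]
        have h1 := hc i
        have h2 := hc i₀
        rw [(hβ1 i₀ hαi₀).resolve_left hβi₀, hαi₀] at h2
        rw [h0, hαi] at h1
        convert sub_mem h2 h1 using 1
        field_simp
        ring
      · exact hβ0 i (not_not.1 fun h => hi ((hT i).2 h))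
    constructor
    · rw [← hcompl, hcT, Nat.add_left_cancel_iff]
      have h1 : (T.card : ℝ) * (1 / (p * q)) + Tᶜ.card * (1 / p) = q * K := by
        rw [← hsβ, ← Finset.sum_add_sum_compl T, Finset.sum_congr rfl fun i hi => by
          rw [hβT, if_pos hi], Finset.sum_congr (s₁ := Tᶜ) rfl fun i hi => by
          rw [hβT, if_neg (Finset.mem_compl.1 hi)]]
        simp
      rw [hcT] at h1
      push_cast at h1
      field_simp at h1
      have h2 : K + Tᶜ.card = p * q * K := by
        have : (K + Tᶜ.card : ℝ) = p * q * K := by linarith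
        exact_mod_cast this
      rw [Nat.sub_mul, one_mul]
      omega
    · refine fun x => ⟨fun hx => ?_, fun ⟨m, hm⟩ => ?_⟩
      · obtain ⟨m, l, hml⟩ := hgen x hx
        -- In this pattern pβ ≡ α modulo integers, so lα is absorbed into lpβ.
        refine ⟨m + l * p, fun i => ?_⟩
        have h1 := hml i
        rw [hαT, hβT] at h1
        split_ifs at h1 ⊢ with hi
        · convert h1 using 1
          push_cast
          field_simp
        · convert sub_mem h1 (natCast_mem intReals l) using 1
          push_cast
          field_simp
          ring
      · refine nsmul_add_nsmul_add_mem hα.1 hβ.1 m 0 fun i => ?_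
        rw [hβT]
        simpa using hm i
  · right
    push Not at hex
    have hβT : ∀ i, β i = if i ∈ T then 0 else 1 / (p : ℝ) := fun i => by
      split_ifs with hi
      · exact hex i hi
      · exact hβ0 i (not_not.1 fun h => hi ((hT i).2 h))
    constructor
    · rw [← hcompl, hcT, Nat.add_left_cancel_iff]
      have h1 : (Tᶜ.card : ℝ) * (1 / p) = q * K := by
        rw [← hsβ, ← Finset.sum_add_sum_compl T, Finset.sum_congr rfl fun i hi => by
          rw [hβT, if_pos hi], Finset.sum_congr (s₁ := Tᶜ) rfl fun i hi => by
          rw [hβT, if_neg (Finset.mem_compl.1 hi)]]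
        simp
      field_simp at h1
      exact_mod_cast h1
    · refine fun x => ⟨fun hx => ?_, fun ⟨m, l, hm⟩ => ?_⟩
      · obtain ⟨m, l, hml⟩ := hgen x hx
        refine ⟨m, l, fun i => ?_⟩
        have h1 := hml i
        rw [hαT, hβT] at h1
        split_ifs at h1 ⊢ with hi
        · convert h1 using 2
          push_cast
          ring
        · convert h1 using 2
          push_cast
          ring
      · refine nsmul_add_nsmul_add_mem hα.1 hβ.1 m l fun i => ?_
        rw [hαT, hβT]
        convert hm i using 2
        split_ifs <;> ring

end Classification

/-! ### Coefficient lattices of the listed simplices. -/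

section Targets

variable {d : ℕ}

/-- The origin followed by the rows of an integer matrix. -/
def originRows (M : Matrix (Fin d) (Fin d) ℤ) : Fin (d + 1) → Fin d → ℤ :=
  Fin.cons 0 fun i => M i

theorem originRows_zero (M : Matrix (Fin d) (Fin d) ℤ) : originRows M 0 = 0 := rfl

theorem originRows_succ (M : Matrix (Fin d) (Fin d) ℤ) (i : Fin d) :
    originRows M i.succ = M i := rfl

theorem hullOriginRows_eq (M : Matrix (Fin d) (Fin d) ℤ) :
    hullOriginRows M = convexHull ℝ (Set.range fun i => intVec (originRows M i)) := by
  rw [hullOriginRows]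
  congr 1
  ext x
  simp only [Set.mem_insert_iff, Set.mem_range, Fin.exists_fin_succ, originRows_zero,
    originRows_succ]
  refine or_congr_left ?_
  have : intVec (0 : Fin d → ℤ) = 0 := by funext i; simp [intVec]
  rw [this, eq_comm]

theorem mem_coordLattice_originRows {M : Matrix (Fin d) (Fin d) ℤ} {x : Fin (d + 1) → ℝ} :
    x ∈ coordLattice (originRows M) ↔
      ∑ i, x i ∈ intReals ∧ ∀ j, ∑ i : Fin d, x i.succ * M i j ∈ intReals := by
  rw [mem_coordLattice]
  refine and_congr_right fun _ => forall_congr' fun j => ?_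
  rw [Fin.sum_univ_succ]
  simp [originRows_zero, originRows_succ]

theorem sum_mul_of_unit_rows {R : Type*} [CommRing R] {M : Fin d → R} {e j : Fin d}
    (hM : ∀ i ≠ e, M i = if i = j then 1 else 0) (x : Fin d → R) :
    ∑ i, x i * M i = x j + x e * (M e - if e = j then 1 else 0) := by
  have h : ∀ i, x i * M i = (if i = j then x i else 0) +
      (if i = e then x i * (M i - if i = j then 1 else 0) else 0) := fun i => by
    by_cases hi : i = e
    · subst hi
      rw [if_pos rfl]
      split_ifs <;> ring
    · rw [hM i hi, if_neg hi]
      simp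
  simp [h, Finset.sum_add_distrib]

theorem sum_mul_of_unit_rows₂ {R : Type*} [CommRing R] {M : Fin d → R} {e e' j : Fin d}
    (hee : e ≠ e') (hM : ∀ i, i ≠ e → i ≠ e' → M i = if i = j then 1 else 0) (x : Fin d → R) :
    ∑ i, x i * M i = x j + x e * (M e - if e = j then 1 else 0) +
      x e' * (M e' - if e' = j then 1 else 0) := by
  have h : ∀ i, x i * M i = (if i = j then x i else 0) +
      (if i = e then x i * (M i - if i = j then 1 else 0) else 0) +
      (if i = e' then x i * (M i - if i = j then 1 else 0) else 0) := fun i => by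
    by_cases hi : i = e
    · subst hi
      rw [if_neg hee, if_pos rfl]
      split_ifs <;> ring
    · by_cases hi' : i = e'
      · subst hi'
        rw [if_neg hi, if_pos rfl]
        split_ifs <;> ring
      · rw [hM i hi hi', if_neg hi, if_neg hi']
        simp
  simp [h, Finset.sum_add_distrib]

/-- The coefficient of the origin is determined modulo 1 by the others, because the total is an
integer. -/
theorem forall_sub_mem_of_succ {x y : Fin (d + 1) → ℝ} (hx : ∑ i, x i ∈ intReals)
    (hy : ∑ i, y i ∈ intReals) (h : ∀ j : Fin d, x j.succ - y j.succ ∈ intReals) (i : Fin (d + 1)) :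
    x i - y i ∈ intReals := by
  refine Fin.cases ?_ h i
  rw [Fin.sum_univ_succ] at hx hy
  have := sub_mem (sub_mem hx hy) (sum_mem (t := Finset.univ) fun j _ => h j)
  rw [Finset.sum_sub_distrib] at this
  convert this using 1
  ring

theorem sum_mem_of_forall_sub_mem {x y : Fin (d + 1) → ℝ}
    (hy : ∑ i, y i ∈ intReals) (h : ∀ i, x i - y i ∈ intReals) : ∑ i, x i ∈ intReals := by
  have := add_mem hy (sum_mem (t := Finset.univ) fun j _ => h j)
  rw [Finset.sum_sub_distrib] at this
  simpa using this

theorem vertexMatrixA_apply (A : List ℤ) (i j : Fin A.length) :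
    vertexMatrixA A i j = if i.val + 1 = A.length then
      if j = i then A.getD i 0 else A.getD i 0 - A.getD j 0
    else if i = j then 1 else 0 := by
  simp [vertexMatrixA]

theorem vertexMatrixBC_apply (B C : List ℤ) (i j : Fin C.length) :
    vertexMatrixBC B C i j = if i.val + 1 = C.length then
      if j = i then C.getD i 0 else C.getD i 0 - C.getD j 0
    else if i.val + 1 = B.length then
      if j = i then B.getD i 0
      else if j < i then B.getD i 0 - B.getD j 0
      else 0
    else if i = j then 1 else 0 := by
  simp [vertexMatrixBC]

/-- Only the last row is not a unit vector. Its own column says that N times the last coefficient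
x_e is an integer m; column j then reads x_j ≡ a_j x_e modulo 1. So everything is a multiple of `y`.
-/
theorem mem_coordLattice_vertexMatrixA {A : List ℤ} {N : ℕ} (hN : N ≠ 0) {e : Fin A.length}
    (he : e.val + 1 = A.length) (hAe : A.getD e 0 = N) {y : Fin (A.length + 1) → ℝ}
    (hy : ∑ i, y i ∈ intReals) (hya : ∀ j : Fin A.length, j ≠ e → y j.succ = A.getD j 0 / N)
    (hye : y e.succ = 1 / N) (x : Fin (A.length + 1) → ℝ) :
    x ∈ coordLattice (originRows (vertexMatrixA A)) ↔
      ∃ m : ℤ, ∀ i, x i - m * y i ∈ intReals := by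
  have hN' : (N : ℝ) ≠ 0 := by exact_mod_cast hN
  have hrow : ∀ j i, i ≠ e → ((vertexMatrixA A i j : ℤ) : ℝ) = if i = j then 1 else 0 :=
    fun j i hi => by
      rw [vertexMatrixA_apply, if_neg fun h => hi (Fin.ext (by omega))]
      split_ifs <;> simp
  rw [mem_coordLattice_originRows]
  simp only [sum_mul_of_unit_rows (hrow _) fun i => x i.succ]
  have hcole : x e.succ + x e.succ * (((vertexMatrixA A e e : ℤ) : ℝ) - if e = e then 1 else 0) =
      x e.succ * N := by
    rw [vertexMatrixA_apply, if_pos he, if_pos rfl, if_pos rfl, hAe]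
    push_cast
    ring
  have hcol : ∀ j ≠ e, x j.succ +
      x e.succ * (((vertexMatrixA A e j : ℤ) : ℝ) - if e = j then 1 else 0) =
        x j.succ + x e.succ * (N - A.getD j 0) := fun j hj => by
    rw [vertexMatrixA_apply, if_pos he, if_neg hj, if_neg hj.symm, hAe]
    push_cast
    ring
  constructor
  · rintro ⟨hx, hxj⟩
    have h1 := hxj e
    rw [hcole] at h1
    obtain ⟨m, hm⟩ := mem_intReals.1 h1
    have hxe : x e.succ = m / N := by rw [hm]; field_simp
    refine ⟨m, forall_sub_mem_of_succ hx (by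
      rw [← Finset.mul_sum]; exact mul_mem (intCast_mem _ _) hy) fun j => ?_⟩
    by_cases hj : j = e
    · rw [hj, hye, hxe]
      convert zero_mem intReals using 1
      ring
    · have h2 := hxj j
      rw [hcol j hj, hxe] at h2
      rw [hya j hj]
      convert sub_mem h2 (intCast_mem intReals m) using 1
      field_simp
      ring
  · rintro ⟨m, hm⟩
    refine ⟨sum_mem_of_forall_sub_mem (y := fun i => m * y i) (by
      rw [← Finset.mul_sum]; exact mul_mem (intCast_mem _ _) hy) hm, fun j => ?_⟩
    have h1 := hm e.succ
    rw [hye] at h1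
    by_cases hj : j = e
    · rw [hj, hcole]
      convert add_mem (mul_mem h1 (natCast_mem intReals N)) (intCast_mem intReals m) using 1
      field_simp
      ring
    · rw [hcol j hj]
      have h2 := hm j.succ
      rw [hya j hj] at h2
      convert add_mem (add_mem h2 (mul_mem h1 (sub_mem (natCast_mem intReals N)
        (intCast_mem intReals (A.getD j 0))))) (intCast_mem intReals m) using 1
      field_simp
      ring

/-- The entries equal to c in the first part of C cancel the last row in those columns except for
its final entry, so the two blocks of columns decouple: coefficients 1, …, |B| agree modulo 1 with
l/b, the remaining ones with m/c. The origin belongs to the second block. -/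
theorem mem_coordLattice_vertexMatrixBC {B C : List ℤ} {b c : ℕ} (hb : b ≠ 0) (hc : c ≠ 0)
    {e' e : Fin C.length} (hee : e' < e) (he' : e'.val + 1 = B.length) (he : e.val + 1 = C.length)
    (hBe : B.getD e' 0 = b) (hB : ∀ j : Fin C.length, j < e' → B.getD j 0 = 1)
    (hCe : C.getD e 0 = c) (hC : ∀ j : Fin C.length, j ≤ e' → C.getD j 0 = c)
    (hC1 : ∀ j : Fin C.length, e' < j → j < e → C.getD j 0 = 1)
    (hy : ∀ m l : ℤ, ∑ i : Fin (C.length + 1),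
      (if 1 ≤ i.val ∧ i.val ≤ B.length then l / b else m / c : ℝ) ∈ intReals)
    (x : Fin (C.length + 1) → ℝ) :
    x ∈ coordLattice (originRows (vertexMatrixBC B C)) ↔
      ∃ m l : ℤ, ∀ i : Fin (C.length + 1),
        x i - (if 1 ≤ i.val ∧ i.val ≤ B.length then l / b else m / c : ℝ) ∈ intReals := by
  have hb' : (b : ℝ) ≠ 0 := by exact_mod_cast hb
  have hc' : (c : ℝ) ≠ 0 := by exact_mod_cast hc
  have hrow : ∀ j i, i ≠ e' → i ≠ e →
      ((vertexMatrixBC B C i j : ℤ) : ℝ) = if i = j then 1 else 0 := fun j i hi' hi => by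
    rw [vertexMatrixBC_apply, if_neg fun h => hi (Fin.ext (by omega)),
      if_neg fun h => hi' (Fin.ext (by omega))]
    split_ifs <;> simp
  have hentry : ∀ j, ((vertexMatrixBC B C e j : ℤ) : ℝ) =
      if j = e then (c : ℝ) else c - C.getD j 0 := fun j => by
    rw [vertexMatrixBC_apply, if_pos he, hCe]
    split_ifs <;> simp
  have hentry' : ∀ j, ((vertexMatrixBC B C e' j : ℤ) : ℝ) =
      if j = e' then (b : ℝ) else if j < e' then b - 1 else 0 := fun j => by
    have hlt : e'.val < e.val := hee
    rw [vertexMatrixBC_apply, if_neg (by omega), if_pos he', hBe]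
    split_ifs with h1 h2
    · simp
    · rw [hB j h2]; simp
    · simp
  rw [mem_coordLattice_originRows]
  simp only [sum_mul_of_unit_rows₂ hee.ne (hrow _) fun i => x i.succ, hentry, hentry']
  set f : Fin C.length → ℝ := fun j => x j.succ +
    x e'.succ * ((if j = e' then (b : ℝ) else if j < e' then b - 1 else 0) -
      if e' = j then 1 else 0) +
    x e.succ * ((if j = e then (c : ℝ) else c - C.getD j 0) - if e = j then 1 else 0) with hf
  have hfe : f e = x e.succ * c := by
    simp only [hf, if_neg hee.ne', if_neg hee.ne, if_neg hee.not_gt, if_pos]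
    ring
  have hfe' : f e' = x e'.succ * b := by
    simp only [hf, if_neg hee.ne', if_neg hee.ne, if_pos, hC e' le_rfl]
    push_cast
    ring
  have hf1 : ∀ j < e', f j = x j.succ + x e'.succ * (b - 1) := fun j hj => by
    simp only [hf, if_neg hj.ne', if_neg hj.ne, if_pos hj, if_neg (hj.trans hee).ne,
      if_neg (hj.trans hee).ne', hC j hj.le]
    push_cast
    ring
  have hf2 : ∀ j, e' < j → j < e → f j = x j.succ + x e.succ * (c - 1) := fun j hj hj' => by
    simp only [hf, if_neg hj.ne', if_neg hj.ne, if_neg hj.not_gt, if_neg hj'.ne, if_neg hj'.ne',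
      hC1 j hj hj']
    push_cast
    ring
  have hpat : ∀ (m l : ℤ) (j : Fin C.length),
      (if 1 ≤ j.succ.val ∧ j.succ.val ≤ B.length then l / b else m / c : ℝ) =
        if j ≤ e' then (l / b : ℝ) else m / c := fun m l j => by
    have : (1 ≤ j.succ.val ∧ j.succ.val ≤ B.length) ↔ j ≤ e' := by
      rw [Fin.val_succ, Fin.le_def]
      omega
    simp only [this]
  have hcases : ∀ j : Fin C.length, j < e' ∨ j = e' ∨ (e' < j ∧ j < e) ∨ j = e := fun j => by
    simp only [Fin.lt_def, Fin.ext_iff]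
    omega
  constructor
  · rintro ⟨hx, hxj⟩
    have h1 := hxj e
    change f e ∈ _ at h1
    have h2 := hxj e'
    change f e' ∈ _ at h2
    rw [hfe] at h1
    rw [hfe'] at h2
    obtain ⟨m, hm⟩ := mem_intReals.1 h1
    obtain ⟨l, hl⟩ := mem_intReals.1 h2
    have hxe : x e.succ = m / c := by rw [hm]; field_simp
    have hxe' : x e'.succ = l / b := by rw [hl]; field_simp
    refine ⟨m, l, forall_sub_mem_of_succ hx (hy m l) fun j => ?_⟩
    rw [hpat]
    rcases hcases j with hj | rfl | ⟨hj, hj'⟩ | rfl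
    · have h3 := hxj j
      change f j ∈ _ at h3
      rw [hf1 j hj, hxe'] at h3
      rw [if_pos hj.le]
      convert sub_mem h3 (intCast_mem intReals l) using 1
      field_simp
      ring
    · rw [if_pos le_rfl, hxe', sub_self]
      exact zero_mem _
    · have h3 := hxj j
      change f j ∈ _ at h3
      rw [hf2 j hj hj', hxe] at h3
      rw [if_neg hj.not_ge]
      convert sub_mem h3 (intCast_mem intReals m) using 1
      field_simp
      ring
    · rw [if_neg hee.not_ge, hxe, sub_self]
      exact zero_mem _
  · rintro ⟨m, l, hml⟩
    refine ⟨sum_mem_of_forall_sub_mem (hy m l) hml, fun j => ?_⟩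
    have hj0 := fun j : Fin C.length => hml j.succ
    simp only [hpat] at hj0
    have h1 := hj0 e
    have h2 := hj0 e'
    rw [if_neg hee.not_ge] at h1
    rw [if_pos le_rfl] at h2
    change f j ∈ _
    rcases hcases j with hj | rfl | ⟨hj, hj'⟩ | rfl
    · have h3 := hj0 j
      rw [if_pos hj.le] at h3
      rw [hf1 j hj]
      convert add_mem (add_mem h3 (mul_mem h2 (sub_mem (natCast_mem intReals b)
        (one_mem intReals)))) (intCast_mem intReals l) using 1
      field_simp
      ring
    · rw [hfe']
      convert add_mem (mul_mem h2 (natCast_mem intReals b)) (intCast_mem intReals l) using 1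
      field_simp
      ring
    · have h3 := hj0 j
      rw [if_neg hj.not_ge] at h3
      rw [hf2 j hj hj']
      convert add_mem (add_mem h3 (mul_mem h1 (sub_mem (natCast_mem intReals c)
        (one_mem intReals)))) (intCast_mem intReals m) using 1
      field_simp
      ring
    · rw [hfe]
      convert add_mem (mul_mem h1 (natCast_mem intReals c)) (intCast_mem intReals m) using 1
      field_simp
      ring

end Targets

/-! ### Matching the lattices with the listed simplices. -/

section Conclusion

theorem exists_perm_mem_iff {n : ℕ} {T P : Finset (Fin n)} (h : T.card = P.card) :
    ∃ σ : Equiv.Perm (Fin n), ∀ i, σ i ∈ P ↔ i ∈ T := by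
  let σ₀ : {i // i ∈ T} ≃ {i // i ∈ P} := Finset.equivOfCardEq h
  refine ⟨σ₀.extendSubtype, fun i => ⟨fun hi => ?_, fun hi => σ₀.extendSubtype_mem i hi⟩⟩
  by_contra hT
  exact σ₀.extendSubtype_not_mem i hT hi

theorem unimodularlyEquivalent_simplexA {A : List ℤ} {N : ℕ} (hN : N ≠ 0) {e : Fin A.length}
    (he : e.val + 1 = A.length) (hAe : A.getD e 0 = N)
    {v : Fin (A.length + 1) → Fin A.length → ℤ} (hv : AffineIndependent ℝ fun i => intVec (v i))
    {T P : Finset (Fin (A.length + 1))} (hTP : T.card = P.card) {s t : ℝ}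
    (hΛ : ∀ x, x ∈ coordLattice v ↔
      ∃ m : ℤ, ∀ i, x i - m * (if i ∈ T then s else t) ∈ intReals)
    (ha : ∀ j : Fin A.length, j ≠ e → (if j.succ ∈ P then s else t) = A.getD j 0 / N)
    (hl : (if e.succ ∈ P then s else t) = 1 / N) :
    UnimodularlyEquivalent (convexHull ℝ (Set.range fun i => intVec (v i))) (simplexA A) := by
  obtain ⟨σ, hσ⟩ := exists_perm_mem_iff hTP
  -- The generator itself lies in Λ, so its coordinate sum is an integer; permuting coordinates
  -- preserves the sum.
  have hsum : ∑ i, (if i ∈ P then s else t) ∈ intReals := by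
    have h1 : (fun i => if i ∈ T then s else t) ∈ coordLattice v :=
      (hΛ _).2 ⟨1, fun i => by simp [zero_mem]⟩
    rw [← Equiv.sum_comp σ]
    simpa only [hσ] using h1.1
  rw [simplexA, hullOriginRows_eq]
  refine unimodularlyEquivalent_of_permuted_coordLattice hv σ fun x => ?_
  rw [mem_coordLattice_vertexMatrixA hN he hAe hsum ha hl, hΛ]
  refine exists_congr fun m => ?_
  rw [← Equiv.forall_congr_right σ]
  simp only [hσ]

theorem unimodularlyEquivalent_simplexBC {B C : List ℤ} {b c : ℕ} (hb : b ≠ 0) (hc : c ≠ 0)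
    {e' e : Fin C.length} (hee : e' < e) (he' : e'.val + 1 = B.length) (he : e.val + 1 = C.length)
    (hBe : B.getD e' 0 = b) (hB : ∀ j : Fin C.length, j < e' → B.getD j 0 = 1)
    (hCe : C.getD e 0 = c) (hC : ∀ j : Fin C.length, j ≤ e' → C.getD j 0 = c)
    (hC1 : ∀ j : Fin C.length, e' < j → j < e → C.getD j 0 = 1)
    {v : Fin (C.length + 1) → Fin C.length → ℤ} (hv : AffineIndependent ℝ fun i => intVec (v i))
    {T : Finset (Fin (C.length + 1))} (hT : T.card = B.length)
    (hΛ : ∀ x, x ∈ coordLattice v ↔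
      ∃ m l : ℤ, ∀ i, x i - (if i ∈ T then l / b else m / c : ℝ) ∈ intReals) :
    UnimodularlyEquivalent (convexHull ℝ (Set.range fun i => intVec (v i))) (simplexBC B C) := by
  let P : Finset (Fin (C.length + 1)) :=
    Finset.univ.filter fun i => 1 ≤ i.val ∧ i.val ≤ B.length
  have hlt : e'.val < e.val := hee
  have hP : P.card = B.length := by
    have h1 : P.map Fin.valEmbedding = Finset.Icc 1 B.length := by
      ext i
      simp only [P, Finset.mem_map, Finset.mem_filter, Finset.mem_univ, true_and,
        Fin.valEmbedding_apply, Finset.mem_Icc]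
      constructor
      · rintro ⟨i, hi, rfl⟩
        exact hi
      · intro hi
        exact ⟨⟨i, by omega⟩, hi, rfl⟩
    rw [← Finset.card_map Fin.valEmbedding, h1, Nat.card_Icc, Nat.add_sub_cancel]
  obtain ⟨σ, hσ⟩ := exists_perm_mem_iff (hT.trans hP.symm)
  have hσ' : ∀ i, (1 ≤ (σ i).val ∧ (σ i).val ≤ B.length) ↔ i ∈ T := fun i => by
    rw [← hσ]
    simp [P]
  have hsum : ∀ m l : ℤ, ∑ i : Fin (C.length + 1),
      (if 1 ≤ i.val ∧ i.val ≤ B.length then l / b else m / c : ℝ) ∈ intReals := fun m l => by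
    have h1 : (fun i => if i ∈ T then (l / b : ℝ) else m / c) ∈ coordLattice v :=
      (hΛ _).2 ⟨m, l, fun i => by simp [zero_mem]⟩
    rw [← Equiv.sum_comp σ]
    simpa only [hσ'] using h1.1
  rw [simplexBC, hullOriginRows_eq]
  refine unimodularlyEquivalent_of_permuted_coordLattice hv σ fun x => ?_
  rw [mem_coordLattice_vertexMatrixBC hb hc hee he' he hBe hB hCe hC hC1 hsum, hΛ]
  refine exists_congr fun m => exists_congr fun l => ?_
  rw [← Equiv.forall_congr_right σ]
  simp only [hσ']

theorem getD_replicate_append (a i : ℕ) (x : ℤ) (L : List ℤ) :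
    (List.replicate a x ++ L).getD i 0 = if i < a then x else L.getD (i - a) 0 := by
  split_ifs with h
  · rw [List.getD_append _ _ _ _ (by simpa using h)]
    simp [h]
  · rw [List.getD_append_right _ _ _ _ (by simpa using h)]
    simp

theorem getD_singleton (x : ℤ) : [x].getD 0 0 = x := rfl

variable {d : ℕ} {v : Fin (d + 1) → Fin d → ℤ}

theorem unimodularlyEquivalent_simplexA_cyclic (hv : AffineIndependent ℝ fun i => intVec (v i))
    {N K : ℕ} (hN : 2 ≤ N) (hNK : 2 ≤ N * K) (hd : d + 1 = N * K)
    (hΛ : ∀ x, x ∈ coordLattice v ↔ ∃ m : ℤ, ∀ i, x i - m * (1 / N : ℝ) ∈ intReals) :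
    UnimodularlyEquivalent (convexHull ℝ (Set.range fun i => intVec (v i)))
      (simplexA (List.replicate (N * K - 2) 1 ++ [(N : ℤ)])) := by
  generalize N * K = n at hd hNK ⊢
  obtain ⟨A, hA⟩ : ∃ A, A = List.replicate (n - 2) 1 ++ [(N : ℤ)] := ⟨_, rfl⟩
  have hlen : A.length = n - 1 := by
    rw [hA]
    simp
    omega
  rw [← hA]
  obtain rfl : d = A.length := by omega
  have hget : ∀ i, i < n - 2 → A.getD i 0 = 1 := fun i hi => by
    rw [hA, getD_replicate_append, if_pos hi]
  have hgetl : A.getD (n - 2) 0 = N := by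
    rw [hA, getD_replicate_append, if_neg (lt_irrefl _), Nat.sub_self, getD_singleton]
  refine unimodularlyEquivalent_simplexA (N := N) (e := ⟨n - 2, by omega⟩) (T := Finset.univ)
    (P := Finset.univ) (s := 1 / N) (t := 1 / N) (by omega) (by simp; omega) hgetl hv rfl
    (by simpa using hΛ) (fun j hj => ?_) (by simp)
  have : j.val < n - 2 := by
    have := j.2
    have h2 : j.val ≠ n - 2 := fun h => hj (Fin.ext h)
    omega
  rw [hget _ this]
  simp

theorem unimodularlyEquivalent_simplexA_two_types
    (hv : AffineIndependent ℝ fun i => intVec (v i)) {p q a b : ℕ} (hp : 2 ≤ p) (hq : 2 ≤ q)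
    (ha : 0 < a) (hb : 0 < b) (hd : d + 1 = a + b) {T : Finset (Fin (d + 1))} (hT : T.card = a)
    (hΛ : ∀ x, x ∈ coordLattice v ↔
      ∃ m : ℤ, ∀ i, x i - m * (if i ∈ T then 1 / (p * q) else 1 / p : ℝ) ∈ intReals) :
    UnimodularlyEquivalent (convexHull ℝ (Set.range fun i => intVec (v i)))
      (simplexA (List.replicate (a - 1) 1 ++ List.replicate (b - 1) (q : ℤ) ++ [(p : ℤ) * q])) := by
  obtain ⟨A, hA⟩ : ∃ A, A = List.replicate (a - 1) 1 ++ List.replicate (b - 1) (q : ℤ) ++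
    [(p : ℤ) * q] := ⟨_, rfl⟩
  have hlen : A.length = a + b - 1 := by
    rw [hA]
    simp
    omega
  rw [← hA]
  obtain rfl : d = A.length := by omega
  have hget : ∀ i, A.getD i 0 = if i < a - 1 then 1 else if i - (a - 1) < b - 1 then (q : ℤ)
      else [(p : ℤ) * q].getD (i - (a - 1) - (b - 1)) 0 := fun i => by
    rw [hA, List.append_assoc, getD_replicate_append, getD_replicate_append]
  -- The vertices of weight 1/(pq) are the first a − 1 unit vectors and the last row. The origin has
  -- weight 1/p, which is why each block of A is one shorter than its set of vertices.
  let P : Finset (Fin (A.length + 1)) :=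
    Finset.univ.filter fun i => (1 ≤ i.val ∧ i.val < a) ∨ i.val = a + b - 1
  have hP : P.card = a := by
    have h1 : P.map Fin.valEmbedding = insert (a + b - 1) (Finset.Ico 1 a) := by
      ext i
      simp only [P, Finset.mem_map, Finset.mem_filter, Finset.mem_univ, true_and,
        Fin.valEmbedding_apply, Finset.mem_Ico, Finset.mem_insert]
      constructor
      · rintro ⟨i, hi, rfl⟩
        exact hi.symm
      · intro hi
        exact ⟨⟨i, by omega⟩, hi.symm, rfl⟩
    rw [← Finset.card_map Fin.valEmbedding, h1, Finset.card_insert_of_notMem, Nat.card_Ico]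
    · omega
    · rw [Finset.mem_Ico]; omega
  have hPmem : ∀ j : Fin A.length, j.succ ∈ P ↔ j.val < a - 1 ∨ j.val = a + b - 2 := fun j => by
    simp only [P, Finset.mem_filter, Finset.mem_univ, true_and, Fin.val_succ]
    omega
  have hp0 : (p : ℝ) ≠ 0 := by positivity
  have hq0 : (q : ℝ) ≠ 0 := by positivity
  refine unimodularlyEquivalent_simplexA (N := p * q) (e := ⟨a + b - 2, by omega⟩) (T := T)
    (P := P) (s := 1 / (p * q)) (t := 1 / p) (by positivity) (by simp; omega) ?_ hv
    (hT.trans hP.symm) hΛ (fun j hj => ?_) ?_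
  · rw [hget, if_neg (by dsimp only; omega), if_neg (by dsimp only; omega),
      show a + b - 2 - (a - 1) - (b - 1) = 0 by omega, getD_singleton]
    push_cast
    rfl
  · have h1 := j.2
    have h2 : j.val ≠ a + b - 2 := fun h => hj (Fin.ext h)
    rw [hget]
    by_cases h : j.val < a - 1
    · rw [if_pos ((hPmem j).2 (Or.inl h)), if_pos h]
      push_cast
      rfl
    · rw [if_neg (by rw [hPmem]; omega), if_neg h, if_pos (by omega)]
      push_cast
      field_simp
  · rw [if_pos ((hPmem _).2 (Or.inr rfl))]
    push_cast
    rfl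

theorem unimodularlyEquivalent_simplexBC_two_types
    (hv : AffineIndependent ℝ fun i => intVec (v i)) {p q a b : ℕ} (hp : 2 ≤ p) (hq : 2 ≤ q)
    (ha : 0 < a) (hb : 2 ≤ b) (hd : d + 1 = a + b) {T : Finset (Fin (d + 1))} (hT : T.card = a)
    (hΛ : ∀ x, x ∈ coordLattice v ↔
      ∃ m l : ℤ, ∀ i, x i - (if i ∈ T then l / q else m / p : ℝ) ∈ intReals) :
    UnimodularlyEquivalent (convexHull ℝ (Set.range fun i => intVec (v i)))
      (simplexBC (List.replicate (a - 1) 1 ++ [(q : ℤ)])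
        (List.replicate a (p : ℤ) ++ List.replicate (b - 2) 1 ++ [(p : ℤ)])) := by
  obtain ⟨B, hB⟩ : ∃ B, B = List.replicate (a - 1) 1 ++ [(q : ℤ)] := ⟨_, rfl⟩
  obtain ⟨C, hC⟩ : ∃ C, C = List.replicate a (p : ℤ) ++ List.replicate (b - 2) 1 ++ [(p : ℤ)] :=
    ⟨_, rfl⟩
  have hBlen : B.length = a := by
    rw [hB]
    simp
    omega
  have hClen : C.length = a + b - 1 := by
    rw [hC]
    simp
    omega
  rw [← hB, ← hC]
  obtain rfl : d = C.length := by omega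
  have hBget : ∀ i, B.getD i 0 = if i < a - 1 then 1 else [(q : ℤ)].getD (i - (a - 1)) 0 :=
    fun i => by rw [hB, getD_replicate_append]
  have hCget : ∀ i, C.getD i 0 = if i < a then (p : ℤ) else if i - a < b - 2 then 1
      else [(p : ℤ)].getD (i - a - (b - 2)) 0 := fun i => by
    rw [hC, List.append_assoc, getD_replicate_append, getD_replicate_append]
  refine unimodularlyEquivalent_simplexBC (b := q) (c := p) (e' := ⟨a - 1, by omega⟩)
    (e := ⟨a + b - 2, by omega⟩) (by omega) (by omega) (by simp; omega) (by simp; omega)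
    (by simp; omega) ?_ (fun j hj => ?_) ?_ (fun j hj => ?_) (fun j hj hj' => ?_) hv
    (hT.trans hBlen.symm) hΛ
  · rw [hBget, if_neg (lt_irrefl _), Nat.sub_self, getD_singleton]
  · rw [hBget, if_pos (Fin.lt_def.1 hj)]
  · rw [hCget, if_neg (by dsimp only; omega), if_neg (by dsimp only; omega),
      show a + b - 2 - a - (b - 2) = 0 by omega, getD_singleton]
  · rw [Fin.le_def] at hj
    rw [hCget, if_pos (by dsimp only at hj; omega)]
  · rw [Fin.lt_def] at hj hj'
    dsimp only at hj hj'
    rw [hCget, if_neg (by omega), if_pos (by omega)]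

theorem unimodularlyEquivalent_of_hasGenerators
    (hv : AffineIndependent ℝ fun i => intVec (v i)) {p q K : ℕ} (hp : 2 ≤ p) (hq : 2 ≤ q)
    (hK : 0 < K) {α β : Fin (d + 1) → ℝ} (H : HasGenerators v p q K α β)
    (hpyr : ∀ i, ∃ x ∈ coordLattice v, x i ∉ intReals) :
    UnimodularlyEquivalent (convexHull ℝ (Set.range fun i => intVec (v i)))
      (simplexA (List.replicate (q * K - 1) 1 ++
        List.replicate ((p * q - 1) * K - 1) (q : ℤ) ++ [(p : ℤ) * q])) ∨
    UnimodularlyEquivalent (convexHull ℝ (Set.range fun i => intVec (v i)))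
      (simplexBC (List.replicate (q * K - 1) 1 ++ [(q : ℤ)])
        (List.replicate (q * K) (p : ℤ) ++ List.replicate (p * q * K - 2) 1 ++ [(p : ℤ)])) := by
  have hpq : 4 ≤ p * q := by nlinarith
  obtain ⟨T, hT, ⟨hd, hΛ⟩ | ⟨hd, hΛ⟩⟩ := coordLattice_two_types hp hq H hpyr
  · exact Or.inl (unimodularlyEquivalent_simplexA_two_types hv hp hq (by positivity)
      (Nat.mul_pos (by omega) hK) hd hT hΛ)
  · exact Or.inr (unimodularlyEquivalent_simplexBC_two_types hv hp hq (by positivity)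
      (by nlinarith) hd hT hΛ)

/-- In dimension 0 a box point has a single coordinate below 1, so its height cannot be K ≥ 1. -/
theorem HasHeights.dim_pos {N K : ℕ} (hN : 2 ≤ N) (hK : 0 < K) (H : HasHeights v N K) : 0 < d := by
  rcases Nat.eq_zero_or_pos d with rfl | hd
  · obtain ⟨x, hx, hxs⟩ := H.exists_eq 1 (by omega)
    have h1 := (hx.2 0).2
    rw [Fin.sum_univ_one, Nat.cast_one, one_mul] at hxs
    have : (1 : ℝ) ≤ K := by exact_mod_cast hK
    linarith
  · exact hd

end Conclusion

theorem corollary3p7 (p q k d : ℕ) (hp : p.Prime) (hq : q.Prime) (hpq : p ≠ q)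
    (Δ : Set (Fin d → ℝ)) (hΔ : IsLatticeSimplex Δ)
    (hδ : IsDeltaPolynomial Δ (∑ i ∈ Finset.range (p * q), (Polynomial.X : ℤ[X]) ^ (i * (k + 1))))
    (hpyr : ¬ IsLatticePyramid Δ) :
    let A₁ : List ℤ := List.replicate (p * q * (k + 1) - 2) 1 ++ [(p : ℤ) * q]
    let B₁ : List ℤ := List.replicate (p * (k + 1) - 1) 1 ++ [(p : ℤ)]
    let C₁ : List ℤ :=
      List.replicate (p * (k + 1)) (q : ℤ) ++ List.replicate (p * q * (k + 1) - 2) 1 ++ [(q : ℤ)]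
    let B₂ : List ℤ := List.replicate (q * (k + 1) - 1) 1 ++ [(q : ℤ)]
    let C₂ : List ℤ :=
      List.replicate (q * (k + 1)) (p : ℤ) ++ List.replicate (p * q * (k + 1) - 2) 1 ++ [(p : ℤ)]
    let A₂ : List ℤ :=
      List.replicate (p * (k + 1) - 1) 1 ++
        List.replicate ((p * q - 1) * (k + 1) - 1) (p : ℤ) ++ [(p : ℤ) * q]
    let A₃ : List ℤ :=
      List.replicate (q * (k + 1) - 1) 1 ++
        List.replicate ((p * q - 1) * (k + 1) - 1) (q : ℤ) ++ [(p : ℤ) * q]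
    UnimodularlyEquivalent Δ (simplexA A₁) ∨
    UnimodularlyEquivalent Δ (simplexA A₂) ∨
    UnimodularlyEquivalent Δ (simplexA A₃) ∨
    UnimodularlyEquivalent Δ (simplexBC B₁ C₁) ∨
    UnimodularlyEquivalent Δ (simplexBC B₂ C₂) := by
  intro A₁ B₁ C₁ B₂ C₂ A₂ A₃
  obtain ⟨v, hv, rfl⟩ := hΔ
  have hK : 0 < k + 1 := k.succ_pos
  have hpq4 : 4 ≤ p * q := by nlinarith [hp.two_le, hq.two_le]
  have H := hasHeights_of_isDeltaPolynomial hv hK hδ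
  have hd := H.dim_pos (by omega) hK
  have hpyr' : ∀ i, ∃ x ∈ coordLattice v, x i ∉ intReals := fun i => by
    by_contra! h
    exact hpyr (isLatticePyramid_of_coord_integral hv hd i h)
  rcases H.exists_generators hp hq hK with ⟨α, hα, hint, hht, hgen⟩ | ⟨α, β, h⟩ | ⟨α, β, h⟩
  · obtain ⟨hdim, hΛ⟩ := coordLattice_cyclic (by omega) hα hint hht hgen hpyr'
    left
    have := unimodularlyEquivalent_simplexA_cyclic hv (by omega) (by nlinarith) hdim hΛ
    rwa [Nat.cast_mul] at this
  · rcases unimodularlyEquivalent_of_hasGenerators hv hp.two_le hq.two_le hK h hpyr' with h | h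
    · exact Or.inr (Or.inr (Or.inl h))
    · exact Or.inr (Or.inr (Or.inr (Or.inr h)))
  · have := unimodularlyEquivalent_of_hasGenerators hv hq.two_le hp.two_le hK h hpyr'
    rw [mul_comm q p, mul_comm (q : ℤ) p] at this
    rcases this with h | h
    · exact Or.inr (Or.inl h)
    · exact Or.inr (Or.inr (Or.inr (Or.inl h)))
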